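/- Let $A$ be a separable $C^*$-algebra (not necessarily unital) and $n\ge 0$ an integer. Let $S^A(\mathbb R^n)$ be the space of $A$-valued Schwartz functions, regarded as a pre-Hilbert (right) $A$-module with $\langle f,g\rangle=\int_{\mathbb R^n} f(x)^*g(x)\,dx$ and norm $\|f\|_2=\|\langle f,f\rangle\|^{1/2}$. Let $CB^\infty(\mathbb R^{2n},A)$ be the space of $C^\infty$ functions $a:\mathbb R^n\times\mathbb R^n\to A$ that are bounded together with all their derivatives, and put $$\pi(a)=\sup\{\|\partial_x^\beta\partial_\xi^\gamma a(x,\xi)\| : x,\xi\in\mathbb R^n,\ \beta,\gamma\in\mathbb N^n,\ \beta,\gamma\le(1,\dots,1)\}.$$ For $a\in CB^\infty(\mathbb R^{2n},A)$ and $u\in S^A(\mathbb R^n)$ let $$a(x,D)u(x)=(2\pi)^{-n}\iint e^{i(x-y)\cdot\xi}a(x,\xi)u(y)\,dy\,d\xi ,$$ understood as an oscillatory integral, i.e. as $$\lim_{m,k\to\infty}(2\pi)^{-n}\iint e^{i(x-y)\cdot\xi}a(x,\xi)u(y)\psi_m(y)\psi'_k(\xi)\,dy\,d\xi$$ for arbitrary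 sequences $\psi_m,\psi'_k\in C_c^\infty(\mathbb R^n)$ each of whose derivatives is bounded uniformly in the index of the sequence, and which are equal to $1$ on balls about the origin with radii tending to infinity (the limit exists and does not depend on these sequences). Then there is a constant $k>0$ such that, for every $a\in CB^\infty(\mathbb R^{2n},A)$, the formula above defines a linear operator $a(x,D):S^A(\mathbb R^n)\to S^A(\mathbb R^n)$ which is right $A$-linear, that is $a(x,D)(ub)=(a(x,D)u)b$ for $b\in A$, and continuous for $\|\cdot\|_2$, with $$\|a(x,D)u\|_2\le k\,\pi(a)\,\|u\|_2\qquad\text{for all }u\in S^A(\mathbb R^n),$$ that is, $\|a(x,D)\|\le k\,\pi(a)$, where $k$ does not depend on $a$. -/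

import Mathlib

open Filter Topology MeasureTheory
open scoped SchwartzMap ContDiff

/-- Real `n`-space with its Euclidean structure. -/
abbrev RSpace (n : ℕ) : Type := EuclideanSpace ℝ (Fin n)

/-- The `i`-th standard basis vector of `ℝⁿ`. -/
noncomputable def stdVec {n : ℕ} (i : Fin n) : RSpace n := EuclideanSpace.single i (1 : ℝ)

section Derivatives

variable {E F : Type*} [NormedAddCommGroup E] [NormedSpace ℝ E]
  [NormedAddCommGroup F] [NormedSpace ℝ F]

/-- The space `CB^∞`: smooth functions that are bounded together with all their derivatives. -/
def IsCBInfty (f : E → F) : Prop :=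
  ContDiff ℝ ∞ f ∧ ∀ j : ℕ, ∃ C : ℝ, ∀ z : E, ‖iteratedFDeriv ℝ j f z‖ ≤ C

/-- The iterated partial derivative `∂_{b 0}^{β 0} ⋯ ∂_{b (n-1)}^{β (n-1)} f`, where `∂_v` is the
derivative in the direction `v`. -/
noncomputable def multiDeriv {n : ℕ} (b : Fin n → E) (β : Fin n → ℕ) (f : E → F) : E → F :=
  (List.finRange n).foldr (fun i g => (fun h z => lineDeriv ℝ h z (b i))^[β i] g) f

end Derivatives

section Symbols

variable {n : ℕ} {A : Type*} [NonUnitalCStarAlgebra A]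

/-- The mixed derivative `∂_x^β ∂_ξ^γ a` of a function `a(x, ξ)` on `ℝⁿ × ℝⁿ`. -/
noncomputable def mixedDeriv (β γ : Fin n → ℕ) (a : RSpace n × RSpace n → A) :
    RSpace n × RSpace n → A :=
  multiDeriv (fun i => (stdVec i, 0)) β (multiDeriv (fun i => (0, stdVec i)) γ a)

/-- `π(a) = sup { ‖∂_x^β ∂_ξ^γ a‖_∞ : β, γ ≤ (1, …, 1) }`. -/
noncomputable def symbolNorm (a : RSpace n × RSpace n → A) : ℝ :=
  sSup {r : ℝ | ∃ (β γ : Fin n → ℕ) (z : RSpace n × RSpace n),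
    β ≤ 1 ∧ γ ≤ 1 ∧ r = ‖mixedDeriv β γ a z‖}

/-- The `A`-valued inner product `⟨f, g⟩ = ∫ f(x)* g(x) dx` on `S^A(ℝⁿ)`. -/
noncomputable def schwartzInner (f g : 𝓢(RSpace n, A)) : A := ∫ x, star (f x) * g x

/-- The norm `‖f‖₂ = ‖⟨f, f⟩‖^{1/2}` on `S^A(ℝⁿ)`. -/
noncomputable def schwartzNorm₂ (f : 𝓢(RSpace n, A)) : ℝ := Real.sqrt ‖schwartzInner f f‖

/-- A sequence of cut-off functions: `ψ_m ∈ C_c^∞(ℝⁿ)`, each derivative is bounded uniformly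
in `m`, and `ψ_m = 1` on the ball of radius `r_m` about the origin, where `r_m → ∞`. -/
structure IsCutoffSeq (ψ : ℕ → RSpace n → ℂ) : Prop where
  smooth : ∀ m, ContDiff ℝ ∞ (ψ m)
  compact_support : ∀ m, HasCompactSupport (ψ m)
  bounded : ∀ j : ℕ, ∃ c : ℝ, ∀ m x, ‖iteratedFDeriv ℝ j (ψ m) x‖ ≤ c
  eq_one : ∃ r : ℕ → ℝ, Tendsto r atTop atTop ∧ ∀ m, ∀ x ∈ Metric.ball (0 : RSpace n) (r m), ψ m x = 1

/-- The truncated double integral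
`(2π)^{-n} ∫ ∫ e^{i (x - y)·ξ} a(x, ξ) u(y) ψ(y) ψ'(ξ) dy dξ`. -/
noncomputable def truncatedIntegral (a : RSpace n × RSpace n → A) (u : RSpace n → A)
    (ψ ψ' : RSpace n → ℂ) (x : RSpace n) : A :=
  (((2 * Real.pi) ^ n)⁻¹ : ℝ) • ∫ ξ : RSpace n, ∫ y : RSpace n,
    (Complex.exp (Complex.I * ((inner ℝ (x - y) ξ : ℝ) : ℂ)) * ψ y * ψ' ξ) • (a (x, ξ) * u y)

/-- `w` is the oscillatory integral `(2π)^{-n} ∫ ∫ e^{i (x - y)·ξ} a(x, ξ) u(y) dy dξ`: for all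
cut-off sequences `ψ_m`, `ψ'_k`, the truncated integrals converge to `w` as `k, m → ∞` jointly. -/
def HasOscIntegral (a : RSpace n × RSpace n → A) (u : RSpace n → A) (x : RSpace n) (w : A) : Prop :=
  ∀ ψ ψ' : ℕ → RSpace n → ℂ, IsCutoffSeq ψ → IsCutoffSeq ψ' →
    Tendsto (fun p : ℕ × ℕ => truncatedIntegral a u (ψ p.1) (ψ' p.2) x) atTop (𝓝 w)

/-- `T` is the pseudo-differential operator `a(x, D)` on `S^A(ℝⁿ)` with symbol `a`. -/
def IsPseudoDiffOp (a : RSpace n × RSpace n → A) (T : 𝓢(RSpace n, A) →ₗ[ℂ] 𝓢(RSpace n, A)) : Prop :=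
  ∀ (u : 𝓢(RSpace n, A)) (x : RSpace n), HasOscIntegral a u x (T u x)

end Symbols

/-! After the substitution ξ = 2πη the operator is Tu(x) = ∫ e^{2πi x·η} a(x, 2πη) û(η) dη, an
absolutely convergent integral because û is Schwartz. Its x-derivatives are integrals of the same
kind, and its value at x is a Fourier transform at -x of a Schwartz function whose seminorms are
bounded uniformly in x; hence Tu is Schwartz. Dominated convergence, with uniform Fourier decay of
the truncated functions ψ_m u, identifies T with the oscillatory integral.

The norm bound is a Calderón–Vaillancourt estimate proved by short-time Fourier transforms, as in
Hwang's argument. Take h(t) = ∏ⱼ (1 - 2πi tⱼ)⁻¹ and let U(x, η) be the transform of u with window h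
centred at x. Since ∂_{ηⱼ} acts on a Fourier transform as multiplication by -2πi tⱼ under the
integral, ∏ⱼ (1 + ∂_{ηⱼ}) [e^{2πi x·η} U(x, η)] = e^{2πi x·η} û(η). Integration by parts puts ∏ⱼ (1
- ∂_{ηⱼ}) on the symbol alone (`pdoFun_eq_integral_stft`). In the pairing ⟨v, Tu⟩ the same device is
applied in x, with v* = ŵ (`integral_star_mul_planeWave_eq`). Now ∏ⱼ (1 - ∂_{xⱼ}) falls on a product
bU, where x-derivatives of U merely change its window. Each variable is differentiated at most once
on the symbol, which is why π(a) suffices.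

What remains is a sum of phase-space integrals ∬ W b U, with the factors in this order because A is
noncommutative. The Cauchy–Schwarz inequality for Hilbert modules, the inequality (bU)*(bU) ≤ ‖b‖∞²
U*U (`norm_integral_mul_mul_le`) and the orthogonality relations for U and W
(`IsWindow.integral_sesq_stft`) bound it by a constant times π(a) ‖v‖₂ ‖u‖₂. Choosing v = Tu
finishes the proof. -/

/-! ### Classes of functions stable under differentiation -/

section ClosedClasses

variable {E F : Type*} [NormedAddCommGroup E] [NormedSpace ℝ E]
  [NormedAddCommGroup F] [NormedSpace ℝ F]

/-- A class of functions that is closed under taking the components of the derivative. -/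
def IsDerivClosed (P : Set (E → F)) : Prop :=
  ∀ f ∈ P, ∃ (ι : Type) (_ : Fintype ι) (L : ι → E →L[ℝ] ℝ) (g : ι → E → F),
    (∀ i, g i ∈ P) ∧ ∀ x, HasFDerivAt f (∑ i, (L i).smulRight (g i x)) x

theorem IsDerivClosed.contDiff {P : Set (E → F)} (hP : IsDerivClosed P) {f : E → F} (hf : f ∈ P) :
    ContDiff ℝ ∞ f := by
  rw [contDiff_infty]
  intro m
  induction m generalizing f with
  | zero =>
    obtain ⟨ι, _, L, g, -, hfg⟩ := hP f hf
    exact contDiff_zero.2 (continuous_iff_continuousAt.2 fun x => (hfg x).continuousAt)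
  | succ m ih =>
    obtain ⟨ι, _, L, g, hg, hfg⟩ := hP f hf
    push_cast
    refine contDiff_succ_iff_fderiv.2 ⟨fun x => (hfg x).differentiableAt, by simp, ?_⟩
    have : fderiv ℝ f = fun x => ∑ i, (L i).smulRight (g i x) := funext fun x => (hfg x).fderiv
    rw [this]
    refine ContDiff.sum fun i _ => ?_
    exact (ContinuousLinearMap.smulRightL ℝ E F (L i)).contDiff.comp (ih (hg i))

/-- Components of derivatives stay in the class, so a weighted sup bound on the members themselves
yields one for all their derivatives. This replaces every explicit computation of higher derivatives
below. -/
theorem IsDerivClosed.iteratedFDeriv_bound {P : Set (E → F)} (hP : IsDerivClosed P)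
    {w : E → ℝ} (hw : ∀ x, 0 ≤ w x) (hb : ∀ f ∈ P, ∃ C, ∀ x, w x * ‖f x‖ ≤ C)
    {f : E → F} (hf : f ∈ P) (m : ℕ) : ∃ C, ∀ x, w x * ‖iteratedFDeriv ℝ m f x‖ ≤ C := by
  induction m generalizing f with
  | zero => simpa using hb f hf
  | succ m ih =>
    obtain ⟨ι, _, L, g, hg, hfg⟩ := hP f hf
    choose C hC using fun i => ih (hg i)
    refine ⟨∑ i, ‖ContinuousLinearMap.smulRightL ℝ E F (L i)‖ * C i, fun x => ?_⟩
    have hfd : fderiv ℝ f = fun x => ∑ i, (ContinuousLinearMap.smulRightL ℝ E F (L i)) (g i x) :=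
      funext fun x => (hfg x).fderiv
    have hgd : ∀ i, ContDiff ℝ m (g i) := fun i =>
      (hP.contDiff (hg i)).of_le (by exact_mod_cast le_top)
    have hcd : ∀ i ∈ Finset.univ, ContDiffAt ℝ m
        (fun y => ContinuousLinearMap.smulRightL ℝ E F (L i) (g i y)) x := fun i _ =>
      ((ContinuousLinearMap.smulRightL ℝ E F (L i)).contDiff.comp (hgd i)).contDiffAt
    rw [← norm_iteratedFDeriv_fderiv, hfd, iteratedFDeriv_fun_sum_apply hcd]
    calc w x * ‖∑ i, iteratedFDeriv ℝ m
            (fun y => ContinuousLinearMap.smulRightL ℝ E F (L i) (g i y)) x‖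
        ≤ w x * ∑ i, ‖ContinuousLinearMap.smulRightL ℝ E F (L i)‖ *
            ‖iteratedFDeriv ℝ m (g i) x‖ := by
          refine mul_le_mul_of_nonneg_left ((norm_sum_le _ _).trans (Finset.sum_le_sum fun i _ => ?_))
            (hw x)
          exact ContinuousLinearMap.norm_iteratedFDeriv_comp_left _ (hgd i).contDiffAt le_rfl
      _ = ∑ i, ‖ContinuousLinearMap.smulRightL ℝ E F (L i)‖ *
            (w x * ‖iteratedFDeriv ℝ m (g i) x‖) := by
          rw [Finset.mul_sum]; exact Finset.sum_congr rfl fun i _ => by ring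
      _ ≤ _ := Finset.sum_le_sum fun i _ => mul_le_mul_of_nonneg_left (hC i x) (norm_nonneg (ContinuousLinearMap.smulRightL ℝ E F (L i)))

end ClosedClasses

/-! ### Calculus of smooth functions with bounded derivatives -/

section CBInfty

variable {E E' F F₁ F₂ F₃ : Type*} [NormedAddCommGroup E] [NormedSpace ℝ E]
  [NormedAddCommGroup E'] [NormedSpace ℝ E']
  [NormedAddCommGroup F] [NormedSpace ℝ F] [NormedAddCommGroup F₁] [NormedSpace ℝ F₁]
  [NormedAddCommGroup F₂] [NormedSpace ℝ F₂] [NormedAddCommGroup F₃] [NormedSpace ℝ F₃]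

theorem IsCBInfty.bounded {f : E → F} (hf : IsCBInfty f) : ∃ C, ∀ z, ‖f z‖ ≤ C := by
  simpa using hf.2 0

theorem IsCBInfty.differentiable {f : E → F} (hf : IsCBInfty f) : Differentiable ℝ f :=
  hf.1.differentiable (by simp)

theorem IsCBInfty.clm_comp (L : F₁ →L[ℝ] F₂) {f : E → F₁} (hf : IsCBInfty f) :
    IsCBInfty fun z => L (f z) := by
  refine ⟨L.contDiff.comp hf.1, fun j => ?_⟩
  obtain ⟨C, hC⟩ := hf.2 j
  refine ⟨‖L‖ * C, fun z => ?_⟩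
  exact (L.norm_iteratedFDeriv_comp_left (n := j) (f := f)
    (hf.1.of_le (by exact_mod_cast le_top)).contDiffAt le_rfl).trans
    (mul_le_mul_of_nonneg_left (hC z) (norm_nonneg _))

theorem IsCBInfty.fderiv {f : E → F} (hf : IsCBInfty f) : IsCBInfty (fderiv ℝ f) := by
  refine ⟨hf.1.fderiv_right (by simp), fun j => ?_⟩
  obtain ⟨C, hC⟩ := hf.2 (j + 1)
  exact ⟨C, fun z => by rw [norm_iteratedFDeriv_fderiv]; exact hC z⟩

theorem IsCBInfty.lineDeriv {f : E → F} (hf : IsCBInfty f) (v : E) :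
    IsCBInfty fun z => lineDeriv ℝ f z v := by
  have : (fun z => _root_.lineDeriv ℝ f z v) =
      fun z => ContinuousLinearMap.apply ℝ F v (_root_.fderiv ℝ f z) :=
    funext fun z => (hf.differentiable z).lineDeriv_eq_fderiv
  rw [this]
  exact hf.fderiv.clm_comp _

theorem IsCBInfty.bilinear (B : F₁ →L[ℝ] F₂ →L[ℝ] F₃) {f : E → F₁} {g : E → F₂}
    (hf : IsCBInfty f) (hg : IsCBInfty g) : IsCBInfty fun z => B (f z) (g z) := by
  refine ⟨B.isBoundedBilinearMap.contDiff.comp (hf.1.prodMk hg.1), fun j => ?_⟩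
  choose C hC using hf.2
  choose D hD using hg.2
  refine ⟨‖B‖ * ∑ i ∈ Finset.range (j + 1), (j.choose i : ℝ) * C i * D (j - i), fun z => ?_⟩
  refine (B.norm_iteratedFDeriv_le_of_bilinear hf.1 hg.1 z (n := j)
    (by exact_mod_cast le_top)).trans ?_
  refine mul_le_mul_of_nonneg_left (Finset.sum_le_sum fun i _ => ?_) (norm_nonneg B)
  have hi : 0 ≤ C i := (norm_nonneg _).trans (hC i z)
  gcongr
  · exact hC i z
  · exact hD _ z

theorem IsCBInfty.comp_clm (L : E' →L[ℝ] E) {f : E → F} (hf : IsCBInfty f) :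
    IsCBInfty fun z => f (L z) := by
  refine ⟨hf.1.comp L.contDiff, fun j => ?_⟩
  obtain ⟨C, hC⟩ := hf.2 j
  refine ⟨C * ∏ _i : Fin j, ‖L‖, fun z => ?_⟩
  have := L.iteratedFDeriv_comp_right hf.1 z (i := j) (by exact_mod_cast le_top)
  change ‖iteratedFDeriv ℝ j (f ∘ L) z‖ ≤ _
  rw [this]
  refine (ContinuousMultilinearMap.norm_compContinuousLinearMap_le _ _).trans ?_
  exact mul_le_mul_of_nonneg_right (hC _) (by positivity)

theorem IsCBInfty.comp_const_add (c : E) {f : E → F} (hf : IsCBInfty f) :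
    IsCBInfty fun z => f (c + z) := by
  refine ⟨hf.1.comp (contDiff_const.add contDiff_id), fun j => ?_⟩
  obtain ⟨C, hC⟩ := hf.2 j
  exact ⟨C, fun z => by rw [iteratedFDeriv_comp_add_left]; exact hC _⟩

theorem IsDerivClosed.isCBInfty {P : Set (E → F)} (hP : IsDerivClosed P)
    (hb : ∀ f ∈ P, ∃ C, ∀ x, ‖f x‖ ≤ C) {f : E → F} (hf : f ∈ P) : IsCBInfty f :=
  ⟨hP.contDiff hf, fun j => by
    simpa using hP.iteratedFDeriv_bound (w := fun _ => 1) (by simp) (by simpa using hb) hf j⟩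

variable (E F) in
/-- The vector space of `CB^∞` functions. -/
def CBSpace : Submodule ℝ (E → F) where
  carrier := {f | IsCBInfty f}
  zero_mem' := ⟨contDiff_const, fun j => ⟨0, fun z => by
    rw [show (0 : E → F) = fun _ => 0 from rfl, iteratedFDeriv_fun_zero]; simp⟩⟩
  add_mem' {f g} hf hg := by
    refine ⟨hf.1.add hg.1, fun j => ?_⟩
    obtain ⟨C, hC⟩ := hf.2 j
    obtain ⟨D, hD⟩ := hg.2 j
    refine ⟨C + D, fun z => ?_⟩
    rw [iteratedFDeriv_add_apply (hf.1.of_le (by exact_mod_cast le_top)).contDiffAt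
      (hg.1.of_le (by exact_mod_cast le_top)).contDiffAt]
    exact (norm_add_le _ _).trans (add_le_add (hC z) (hD z))
  smul_mem' c f hf := hf.clm_comp (c • ContinuousLinearMap.id ℝ F)

theorem CBSpace.isCBInfty (f : CBSpace E F) : IsCBInfty (f : E → F) := f.2

/-- The directional derivative as a linear operator on the space of `CB^∞` functions. -/
noncomputable def CBSpace.deriv (v : E) : CBSpace E F →ₗ[ℝ] CBSpace E F where
  toFun f := ⟨fun z => lineDeriv ℝ (f : E → F) z v, f.2.lineDeriv v⟩
  map_add' f g := Subtype.ext <| funext fun z => by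
    have hf := (CBSpace.isCBInfty f).differentiable z
    have hg := (CBSpace.isCBInfty g).differentiable z
    simp [hf.lineDeriv_eq_fderiv, hg.lineDeriv_eq_fderiv, (hf.add hg).lineDeriv_eq_fderiv,
      fderiv_add hf hg]
  map_smul' c f := Subtype.ext <| funext fun z => by
    have hf := (CBSpace.isCBInfty f).differentiable z
    simp [hf.lineDeriv_eq_fderiv, (hf.const_smul c).lineDeriv_eq_fderiv, fderiv_const_smul hf c]

theorem CBSpace.deriv_apply (v : E) (f : CBSpace E F) (z : E) :
    (CBSpace.deriv v f : E → F) z = lineDeriv ℝ (f : E → F) z v := rfl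

theorem CBSpace.hasLineDerivAt (v : E) (f : CBSpace E F) (z : E) :
    HasLineDerivAt ℝ (f : E → F) ((CBSpace.deriv v f : E → F) z) z v :=
  ((CBSpace.isCBInfty f).differentiable z).lineDifferentiableAt.hasLineDerivAt

theorem CBSpace.continuous (f : CBSpace E F) : Continuous (f : E → F) :=
  (CBSpace.isCBInfty f).1.continuous

theorem CBSpace.bounded (f : CBSpace E F) : ∃ C, 0 ≤ C ∧ ∀ z, ‖(f : E → F) z‖ ≤ C := by
  obtain ⟨C, hC⟩ := (CBSpace.isCBInfty f).bounded
  exact ⟨C, (norm_nonneg _).trans (hC 0), hC⟩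

end CBInfty

/-! ### Schwartz and Fourier bounds uniform in a parameter -/

section UniformSchwartz

open scoped FourierTransform

variable {E F F₁ F₂ F₃ : Type*} [NormedAddCommGroup E] [NormedSpace ℝ E]
  [NormedAddCommGroup F] [NormedSpace ℝ F] [NormedAddCommGroup F₁] [NormedSpace ℝ F₁]
  [NormedAddCommGroup F₂] [NormedSpace ℝ F₂] [NormedAddCommGroup F₃] [NormedSpace ℝ F₃]

/-- A family of functions of temperate growth, uniformly in the parameter. -/
def HasUniformTemperateGrowth {ι : Type*} (f : ι → E → F) : Prop :=
  (∀ i, ContDiff ℝ ∞ (f i)) ∧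
    ∀ j : ℕ, ∃ (m : ℕ) (C : ℝ), ∀ i x, ‖iteratedFDeriv ℝ j (f i) x‖ ≤ C * (1 + ‖x‖) ^ m

theorem HasUniformTemperateGrowth.hasTemperateGrowth {ι : Type*} {f : ι → E → F}
    (hf : HasUniformTemperateGrowth f) (i : ι) : (f i).HasTemperateGrowth :=
  ⟨hf.1 i, fun j => let ⟨m, C, h⟩ := hf.2 j; ⟨m, C, h i⟩⟩

theorem IsCBInfty.hasTemperateGrowth {f : E → F} (hf : IsCBInfty f) : f.HasTemperateGrowth :=
  ⟨hf.1, fun j => let ⟨C, h⟩ := hf.2 j; ⟨0, C, by simpa using h⟩⟩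

/-- The Schwartz function `x ↦ B (g x) (u x)`, where `g` is of temperate growth. -/
noncomputable def SchwartzMap.bilinRight (B : F₁ →L[ℝ] F₂ →L[ℝ] F₃) {g : E → F₁}
    (hg : g.HasTemperateGrowth) (u : 𝓢(E, F₂)) : 𝓢(E, F₃) :=
  SchwartzMap.bilinLeftCLM B.flip hg u

@[simp]
theorem SchwartzMap.bilinRight_apply (B : F₁ →L[ℝ] F₂ →L[ℝ] F₃) {g : E → F₁}
    (hg : g.HasTemperateGrowth) (u : 𝓢(E, F₂)) (x : E) :
    SchwartzMap.bilinRight B hg u x = B (g x) (u x) := rfl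

theorem SchwartzMap.exists_one_add_pow_mul_le (u : 𝓢(E, F)) (k j : ℕ) :
    ∃ C, 0 ≤ C ∧ ∀ x, (1 + ‖x‖) ^ k * ‖iteratedFDeriv ℝ j u x‖ ≤ C :=
  ⟨_, by positivity, fun x =>
    SchwartzMap.one_add_le_sup_seminorm_apply (𝕜 := ℝ) (m := (k, j)) le_rfl le_rfl u x⟩

/-- By the Leibniz rule, the polynomial growth of the derivatives of `f i` is absorbed by the decay
of `u`; only the growth constants enter, and these are the same for all `i`. -/
theorem HasUniformTemperateGrowth.exists_seminorm_le {ι : Type*} {f : ι → E → F₁}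
    (hf : HasUniformTemperateGrowth f) (B : F₁ →L[ℝ] F₂ →L[ℝ] F₃) (u : 𝓢(E, F₂)) (k l : ℕ) :
    ∃ C, ∀ i, SchwartzMap.seminorm ℝ k l
      (SchwartzMap.bilinRight B (hf.hasTemperateGrowth i) u) ≤ C := by
  choose m C hC using hf.2
  choose D hD0 hD using fun j => u.exists_one_add_pow_mul_le (k + m j) (l - j)
  refine ⟨‖B‖ * ∑ j ∈ Finset.range (l + 1), (l.choose j : ℝ) * (|C j| * D j), fun i => ?_⟩
  refine SchwartzMap.seminorm_le_bound ℝ k l _ (mul_nonneg (norm_nonneg B)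
    (Finset.sum_nonneg fun j _ => mul_nonneg (by positivity) (mul_nonneg (abs_nonneg _) (hD0 j))))
    fun x => ?_
  have h := B.norm_iteratedFDeriv_le_of_bilinear (hf.1 i) (u.smooth ⊤) x (n := l)
    (by exact_mod_cast le_top)
  refine (mul_le_mul_of_nonneg_left h (by positivity)).trans ?_
  rw [mul_left_comm, Finset.mul_sum]
  refine mul_le_mul_of_nonneg_left (Finset.sum_le_sum fun j _ => ?_) (norm_nonneg B)
  have h1 : ‖iteratedFDeriv ℝ j (f i) x‖ ≤ |C j| * (1 + ‖x‖) ^ m j :=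
    (hC j i x).trans (mul_le_mul_of_nonneg_right (le_abs_self _) (by positivity))
  have h2 : ‖x‖ ^ k ≤ (1 + ‖x‖) ^ k := pow_le_pow_left₀ (norm_nonneg _) (by simp) _
  calc ‖x‖ ^ k * (l.choose j * ‖iteratedFDeriv ℝ j (f i) x‖ * ‖iteratedFDeriv ℝ (l - j) u x‖)
      ≤ (1 + ‖x‖) ^ k * (l.choose j * (|C j| * (1 + ‖x‖) ^ m j) *
          ‖iteratedFDeriv ℝ (l - j) u x‖) := by gcongr
    _ = l.choose j * (|C j| * ((1 + ‖x‖) ^ (k + m j) * ‖iteratedFDeriv ℝ (l - j) u x‖)) := by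
        rw [pow_add]; ring
    _ ≤ _ := by gcongr; exact hD j x

variable {V : Type*} [NormedAddCommGroup V] [InnerProductSpace ℝ V] [FiniteDimensional ℝ V]
  [MeasurableSpace V] [BorelSpace V] {G : Type*} [NormedAddCommGroup G] [NormedSpace ℂ G]

/-- Continuity of the Fourier transform on Schwartz space: each seminorm of a transform is
controlled by finitely many seminorms of the function, so uniform bounds survive. -/
theorem SchwartzMap.exists_fourier_bound {ι : Type*} (Φ : ι → 𝓢(V, G))
    (hΦ : ∀ k l : ℕ, ∃ C, ∀ i, SchwartzMap.seminorm ℝ k l (Φ i) ≤ C) (N : ℕ) :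
    ∃ C, ∀ i ξ, (1 + ‖ξ‖) ^ N * ‖𝓕 (Φ i) ξ‖ ≤ C := by
  let q : Seminorm ℝ 𝓢(V, G) :=
    ((Finset.Iic (N, 0)).sup fun m => SchwartzMap.seminorm ℝ m.1 m.2).comp
      ((FourierTransform.fourierCLM ℝ 𝓢(V, G)).toLinearMap)
  have hq : Continuous q :=
    ((schwartz_withSeminorms ℝ V G).partial_sups.continuous_seminorm (N, 0)).comp
      (FourierTransform.fourierCLM ℝ 𝓢(V, G)).continuous
  obtain ⟨s, C, -, hC⟩ := Seminorm.bound_of_continuous (schwartz_withSeminorms ℝ V G) q hq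
  choose D hD using hΦ
  refine ⟨2 ^ N * (C * ∑ p ∈ s, |D p.1 p.2|), fun i ξ => ?_⟩
  have h1 := SchwartzMap.one_add_le_sup_seminorm_apply (𝕜 := ℝ) (m := (N, 0)) le_rfl le_rfl
    (𝓕 (Φ i)) ξ
  rw [norm_iteratedFDeriv_zero] at h1
  refine h1.trans (mul_le_mul_of_nonneg_left ?_ (by positivity))
  refine (hC (Φ i)).trans ?_
  change (C : ℝ) * (s.sup (schwartzSeminormFamily ℝ V G)) (Φ i) ≤ _
  refine mul_le_mul_of_nonneg_left ?_ C.2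
  refine Seminorm.finset_sup_apply_le (by positivity) fun p hp => ?_
  exact ((hD p.1 p.2 i).trans (le_abs_self _)).trans
    (Finset.single_le_sum (f := fun p : ℕ × ℕ => |D p.1 p.2|) (fun _ _ => abs_nonneg _) hp)

theorem HasUniformTemperateGrowth.exists_fourier_bound {ι : Type*} {f : ι → V → F₁}
    (hf : HasUniformTemperateGrowth f) (B : F₁ →L[ℝ] F₂ →L[ℝ] G) (u : 𝓢(V, F₂)) (N : ℕ) :
    ∃ C, ∀ i ξ, (1 + ‖ξ‖) ^ N *
      ‖𝓕 (SchwartzMap.bilinRight B (hf.hasTemperateGrowth i) u) ξ‖ ≤ C :=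
  SchwartzMap.exists_fourier_bound _ (fun k l => hf.exists_seminorm_le B u k l) N

end UniformSchwartz

/-! ### Differentiation under the integral sign -/

section ParametricIntegral

variable {E F Y : Type*} [NormedAddCommGroup E] [NormedSpace ℝ E]
  [NormedAddCommGroup F] [NormedSpace ℝ F] [CompleteSpace F] [MeasurableSpace Y]
  {μ : Measure Y}

theorem hasFDerivAt_integral_sum_smulRight {ι : Type*} [Fintype ι] {L : ι → E →L[ℝ] ℝ}
    {f : E → Y → F} {g : ι → E → Y → F} {bf : Y → ℝ} {bg : ι → Y → ℝ}
    (hf : ∀ x, AEStronglyMeasurable (f x) μ) (hg : ∀ i x, AEStronglyMeasurable (g i x) μ)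
    (hfb : ∀ x y, ‖f x y‖ ≤ bf y) (hgb : ∀ i x y, ‖g i x y‖ ≤ bg i y)
    (hbf : Integrable bf μ) (hbg : ∀ i, Integrable (bg i) μ)
    (hd : ∀ x y, HasFDerivAt (fun x => f x y) (∑ i, (L i).smulRight (g i x y)) x) (x : E) :
    HasFDerivAt (fun x => ∫ y, f x y ∂μ) (∑ i, (L i).smulRight (∫ y, g i x y ∂μ)) x := by
  have hgi : ∀ i x, Integrable (g i x) μ := fun i x =>
    (hbg i).mono' (hg i x) (Eventually.of_forall (hgb i x))
  have hint : ∀ x, ∫ y, ∑ i, (L i).smulRight (g i x y) ∂μ =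
      ∑ i, (L i).smulRight (∫ y, g i x y ∂μ) := fun x => by
    rw [integral_finsetSum]
    · exact Finset.sum_congr rfl fun i _ =>
        (ContinuousLinearMap.smulRightL ℝ E F (L i)).integral_comp_comm (hgi i x)
    · exact fun i _ => (ContinuousLinearMap.smulRightL ℝ E F (L i)).integrable_comp (hgi i x)
  rw [← hint]
  refine hasFDerivAt_integral_of_dominated_of_fderiv_le (s := Set.univ)
    (bound := fun y => ∑ i, ‖L i‖ * bg i y) Filter.univ_mem
    (Eventually.of_forall hf) (hbf.mono' (hf x) (Eventually.of_forall (hfb x))) ?_ ?_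
    (integrable_finsetSum _ fun i _ => (hbg i).const_mul _)
    (Eventually.of_forall fun y x _ => hd x y)
  · exact (integrable_finsetSum _ fun i _ =>
      (ContinuousLinearMap.smulRightL ℝ E F (L i)).integrable_comp (hgi i x)).1
  · refine Eventually.of_forall fun y x _ => (norm_sum_le _ _).trans (Finset.sum_le_sum fun i _ => ?_)
    rw [ContinuousLinearMap.norm_smulRight_apply]
    exact mul_le_mul_of_nonneg_left (hgb i x y) (norm_nonneg _)

end ParametricIntegral

/-! ### Plane waves -/

section PlaneWaves

variable {n : ℕ} {F : Type*} [NormedAddCommGroup F] [NormedSpace ℝ F]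

/-- The plane wave `e^{2π i x·η}`. -/
noncomputable def planeWave (x η : RSpace n) : ℂ :=
  Complex.exp (((2 * Real.pi * inner ℝ x η : ℝ) : ℂ) * Complex.I)

@[simp]
theorem norm_planeWave (x η : RSpace n) : ‖planeWave x η‖ = 1 :=
  Complex.norm_exp_ofReal_mul_I _

theorem planeWave_comm (x η : RSpace n) : planeWave x η = planeWave η x := by
  rw [planeWave, planeWave, real_inner_comm]

theorem planeWave_add_left (x y η : RSpace n) :
    planeWave (x + y) η = planeWave x η * planeWave y η := by
  rw [planeWave, planeWave, planeWave, ← Complex.exp_add, inner_add_left]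
  push_cast
  ring_nf

@[simp]
theorem planeWave_zero_left (η : RSpace n) : planeWave 0 η = 1 := by simp [planeWave]

theorem planeWave_neg_left (x η : RSpace n) : planeWave (-x) η = star (planeWave x η) := by
  rw [planeWave, planeWave, Complex.star_def, ← Complex.exp_conj, map_mul, Complex.conj_ofReal,
    Complex.conj_I, inner_neg_left]
  push_cast
  ring_nf

theorem planeWave_mul_neg (x η : RSpace n) : planeWave x η * planeWave (-x) η = 1 := by
  rw [← planeWave_add_left]; simp

@[fun_prop]
theorem continuous_planeWave {X : Type*} [TopologicalSpace X] {f g : X → RSpace n}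
    (hf : Continuous f) (hg : Continuous g) : Continuous fun x => planeWave (f x) (g x) := by
  unfold planeWave
  fun_prop

theorem fourier_eq_integral_planeWave {G : Type*} [NormedAddCommGroup G] [NormedSpace ℂ G]
    (f : RSpace n → G) (η : RSpace n) :
    FourierTransform.fourier f η = ∫ y, planeWave (-y) η • f y := by
  rw [Real.fourier_eq']
  refine integral_congr_ae (Eventually.of_forall fun y => ?_)
  simp [planeWave]

theorem clm_eq_sum_proj (L : RSpace n →L[ℝ] F) :
    L = ∑ i, (EuclideanSpace.proj i : RSpace n →L[ℝ] ℝ).smulRight (L (stdVec i)) := by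
  ext x
  conv_lhs => rw [← (EuclideanSpace.basisFun (Fin n) ℝ).sum_repr x, map_sum]
  simp [stdVec]

theorem hasFDerivAt_of_differentiableAt {f : RSpace n → F} {x : RSpace n}
    (hf : DifferentiableAt ℝ f x) :
    HasFDerivAt f (∑ i, (EuclideanSpace.proj i : RSpace n →L[ℝ] ℝ).smulRight
      (lineDeriv ℝ f x (stdVec i))) x := by
  have := hf.hasFDerivAt
  rw [clm_eq_sum_proj (fderiv ℝ f x)] at this
  simpa only [hf.lineDeriv_eq_fderiv] using this

theorem hasFDerivAt_planeWave (x η : RSpace n) :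
    HasFDerivAt (fun x => planeWave x η)
      (∑ i, (EuclideanSpace.proj i : RSpace n →L[ℝ] ℝ).smulRight
        (((2 * Real.pi * Complex.I) * (η i : ℂ)) * planeWave x η)) x := by
  have h1 : HasFDerivAt (fun x : RSpace n => ((2 * Real.pi * inner ℝ x η : ℝ) : ℂ) * Complex.I)
      (((Complex.ofRealCLM.smulRight Complex.I).comp
        ((2 * Real.pi) • ((innerSL ℝ).flip η))) : RSpace n →L[ℝ] ℂ) x := by
    have := (((Complex.ofRealCLM.smulRight Complex.I).comp
        ((2 * Real.pi) • ((innerSL ℝ).flip η))) : RSpace n →L[ℝ] ℂ).hasFDerivAt (x := x)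
    refine this.congr_of_eventuallyEq (Eventually.of_forall fun x => ?_)
    simp [innerSL_apply_apply ℝ, real_inner_comm, mul_assoc]
  have h2 := h1.cexp
  rw [clm_eq_sum_proj (Complex.exp _ • _)] at h2
  refine h2.congr_fderiv (Finset.sum_congr rfl fun i _ => ?_)
  congr 1
  simp [planeWave, stdVec, innerSL_apply_apply ℝ, EuclideanSpace.inner_single_right]
  ring

end PlaneWaves

/-! ### Affine substitutions and slices of symbols -/

section Slices

variable {E E' F : Type*} [NormedAddCommGroup E] [NormedSpace ℝ E]
  [NormedAddCommGroup E'] [NormedSpace ℝ E'] [NormedAddCommGroup F] [NormedSpace ℝ F]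

theorem norm_iteratedFDeriv_comp_const_add_clm_le {f : E → F} (hf : ContDiff ℝ ∞ f) (c : E)
    (L : E' →L[ℝ] E) (j : ℕ) (z : E') :
    ‖iteratedFDeriv ℝ j (fun z => f (c + L z)) z‖ ≤
      ‖iteratedFDeriv ℝ j f (c + L z)‖ * ∏ _i : Fin j, ‖L‖ := by
  have h := L.iteratedFDeriv_comp_right (f := fun z => f (c + z))
    (hf.comp (contDiff_const.add contDiff_id)) z (i := j) (by exact_mod_cast le_top)
  change ‖iteratedFDeriv ℝ j ((fun z => f (c + z)) ∘ L) z‖ ≤ _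
  rw [h, iteratedFDeriv_comp_add_left]
  exact ContinuousMultilinearMap.norm_compContinuousLinearMap_le _ _

theorem IsCBInfty.hasUniformTemperateGrowth {ι : Type*} {f : E → F} (hf : IsCBInfty f)
    (c : ι → E) (L : E' →L[ℝ] E) : HasUniformTemperateGrowth fun i z => f (c i + L z) := by
  refine ⟨fun i => hf.1.comp (contDiff_const.add L.contDiff), fun j => ?_⟩
  obtain ⟨C, hC⟩ := hf.2 j
  refine ⟨0, C * ∏ _i : Fin j, ‖L‖, fun i z => ?_⟩
  rw [pow_zero, mul_one]
  exact (norm_iteratedFDeriv_comp_const_add_clm_le hf.1 _ L j z).trans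
    (mul_le_mul_of_nonneg_right (hC _) (by positivity))

theorem IsCBInfty.hasUniformTemperateGrowth_slice {f : E × E' → F} (hf : IsCBInfty f) :
    HasUniformTemperateGrowth fun x y => f (x, y) := by
  simpa using hf.hasUniformTemperateGrowth (fun x : E => (x, (0 : E')))
    (ContinuousLinearMap.inr ℝ E E')

theorem IsCBInfty.comp_const_add_clm {f : E → F} (hf : IsCBInfty f) (c : E) (L : E' →L[ℝ] E) :
    IsCBInfty fun z => f (c + L z) := by
  refine ⟨hf.1.comp (contDiff_const.add L.contDiff), fun j => ?_⟩
  obtain ⟨C, hC⟩ := hf.2 j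
  exact ⟨C * ∏ _i : Fin j, ‖L‖, fun z =>
    (norm_iteratedFDeriv_comp_const_add_clm_le hf.1 _ L j z).trans
      (mul_le_mul_of_nonneg_right (hC _) (by positivity))⟩

theorem IsCBInfty.slice_right {f : E × E' → F} (hf : IsCBInfty f) (x : E) :
    IsCBInfty fun y => f (x, y) := by
  simpa using hf.comp_const_add_clm (x, (0 : E')) (ContinuousLinearMap.inr ℝ E E')

theorem IsCBInfty.slice_left {f : E × E' → F} (hf : IsCBInfty f) (y : E') :
    IsCBInfty fun x => f (x, y) := by
  simpa using hf.comp_const_add_clm ((0 : E), y) (ContinuousLinearMap.inl ℝ E E')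

end Slices

/-! ### The operator on Schwartz space -/

section Operator

open scoped FourierTransform LineDeriv

variable {n : ℕ} {A : Type*} [NonUnitalCStarAlgebra A]

/-- The function `x ↦ ∫ e^{2π i x·η} a(x, η) û(η) dη`. -/
noncomputable def pdoFun (a : RSpace n × RSpace n → A) (u : 𝓢(RSpace n, A)) (x : RSpace n) : A :=
  ∫ η, planeWave x η • (a (x, η) * 𝓕 u η)

variable {a : RSpace n × RSpace n → A}

theorem norm_planeWave_smul_mul_le {C : ℝ} (hC : ∀ z, ‖a z‖ ≤ C) (v : A) (x η : RSpace n) :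
    ‖planeWave x η • (a (x, η) * v)‖ ≤ C * ‖v‖ := by
  rw [norm_smul, norm_planeWave, one_mul]
  exact (norm_mul_le _ _).trans (mul_le_mul_of_nonneg_right (hC _) (norm_nonneg _))

theorem integrable_pdoFun_integrand (ha : IsCBInfty a) (u : 𝓢(RSpace n, A)) (x : RSpace n) :
    Integrable fun η => planeWave x η • (a (x, η) * 𝓕 u η) := by
  obtain ⟨C, hC⟩ := ha.bounded
  have hc := ha.1.continuous
  refine ((𝓕 u).integrable.norm.const_mul C).mono' ?_
    (Eventually.of_forall fun η => norm_planeWave_smul_mul_le hC _ x η)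
  exact Continuous.aestronglyMeasurable (by fun_prop)

theorem lineDeriv_slice_left (a : RSpace n × RSpace n → A) (x η v : RSpace n) :
    lineDeriv ℝ (fun x => a (x, η)) x v = lineDeriv ℝ a (x, η) (v, 0) := by
  simp [lineDeriv]

/-- The product rule gives two families of terms. Differentiating the plane wave produces 2πi ηⱼ û,
the transform of ∂ⱼu; differentiating the symbol produces ∂_{xⱼ}a. Both are again of the form
`pdoFun`, whence the index type `Fin n ⊕ Fin n`. -/
theorem hasFDerivAt_pdoFun (ha : IsCBInfty a) (u : 𝓢(RSpace n, A)) (x : RSpace n) :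
    HasFDerivAt (pdoFun a u)
      (∑ i : Fin n ⊕ Fin n,
        (EuclideanSpace.proj (i.elim id id) : RSpace n →L[ℝ] ℝ).smulRight
          (pdoFun (i.elim (fun _ => a) fun j z => lineDeriv ℝ a z (stdVec j, 0))
            (i.elim (fun j => ∂_{stdVec j} u) fun _ => u) x)) x := by
  have hsym : ∀ i : Fin n ⊕ Fin n, IsCBInfty
      (i.elim (fun _ => a) fun j z => lineDeriv ℝ a z (stdVec j, 0)) := by
    rintro (j | j)
    · exact ha
    · exact ha.lineDeriv _
  obtain ⟨C, hC⟩ := ha.bounded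
  choose D hD using fun i => (hsym i).bounded
  refine hasFDerivAt_integral_sum_smulRight
    (L := fun i : Fin n ⊕ Fin n => (EuclideanSpace.proj (i.elim id id) : RSpace n →L[ℝ] ℝ))
    (bf := fun η => C * ‖𝓕 u η‖)
    (bg := fun i η => D i * ‖𝓕 (i.elim (fun j => ∂_{stdVec j} u) fun _ => u : 𝓢(RSpace n, A)) η‖)
    (fun x => (integrable_pdoFun_integrand ha u x).1)
    (fun i x => (integrable_pdoFun_integrand (hsym i) _ x).1)
    (fun x η => norm_planeWave_smul_mul_le hC _ x η)
    (fun i x η => norm_planeWave_smul_mul_le (hD i) _ x η)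
    ((𝓕 u).integrable.norm.const_mul C) (fun i => (SchwartzMap.integrable _).norm.const_mul _) ?_ x
  intro x η
  have h1 := hasFDerivAt_planeWave x η
  have h2 := hasFDerivAt_of_differentiableAt ((ha.slice_left η).differentiable x)
  simp only [lineDeriv_slice_left a] at h2
  have h3 := ((ContinuousLinearMap.mul ℝ A).flip (𝓕 u η)).hasFDerivAt.comp x h2
  have h4 := h1.smul h3
  refine h4.congr_fderiv ?_
  ext v
  have hF : ∀ i : Fin n, 𝓕 (∂_{stdVec i} u) η = (2 * Real.pi * Complex.I * (η i : ℂ)) • 𝓕 u η := by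
    intro i
    rw [SchwartzMap.fourier_lineDerivOp_eq, smul_apply,
      SchwartzMap.smulLeftCLM_apply_apply (by fun_prop), mul_smul (2 * Real.pi * Complex.I),
      Complex.coe_smul]
    simp [stdVec, EuclideanSpace.inner_single_right]
  simp only [Fintype.sum_sum_type, add_apply, sum_apply,
    ContinuousLinearMap.smulRight_apply, smul_apply, Sum.elim_inl,
    Sum.elim_inr, hF, ContinuousLinearMap.comp_apply, map_sum, Finset.smul_sum,
    Finset.sum_smul, Function.comp_apply, ContinuousLinearMap.flip_apply,
    ContinuousLinearMap.mul_apply', map_smul]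
  rw [add_comm]
  congr 1
  · refine Finset.sum_congr rfl fun i _ => ?_
    rw [smul_assoc, mul_smul_comm, smul_smul (planeWave x η), mul_comm (planeWave x η)]
    rfl
  · refine Finset.sum_congr rfl fun i _ => ?_
    exact (smul_comm _ _ _).symm

/-- For fixed x the integral is the Fourier transform of a(x, ·)û. It decays rapidly, uniformly in
the parameter x, so its frequency may be set equal to -x. -/
theorem pdoFun_decay (ha : IsCBInfty a) (u : 𝓢(RSpace n, A)) (k : ℕ) :
    ∃ C, ∀ x, ‖x‖ ^ k * ‖pdoFun a u x‖ ≤ C := by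
  obtain ⟨C, hC⟩ := ha.hasUniformTemperateGrowth_slice.exists_fourier_bound
    (ContinuousLinearMap.mul ℝ A) (𝓕 u) k
  refine ⟨C, fun x => le_trans ?_ (hC x (-x))⟩
  have : pdoFun a u x = 𝓕 (SchwartzMap.bilinRight (ContinuousLinearMap.mul ℝ A)
      (ha.hasUniformTemperateGrowth_slice.hasTemperateGrowth x) (𝓕 u)) (-x) := by
    rw [SchwartzMap.fourier_coe, fourier_eq_integral_planeWave]
    refine integral_congr_ae (Eventually.of_forall fun η => ?_)
    simp [planeWave, real_inner_comm]
  rw [this, norm_neg]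
  gcongr
  simp

theorem isDerivClosed_pdoFun :
    IsDerivClosed {f : RSpace n → A | ∃ a u, IsCBInfty a ∧ f = pdoFun a u} := by
  rintro _ ⟨a, u, ha, rfl⟩
  refine ⟨Fin n ⊕ Fin n, inferInstance, _, _, ?_, hasFDerivAt_pdoFun ha u⟩
  rintro (j | j)
  · exact ⟨_, _, ha, rfl⟩
  · exact ⟨_, _, ha.lineDeriv _, rfl⟩

/-- The pseudo-differential operator `u ↦ ∫ e^{2π i x·η} a(x, η) û(η) dη` on `S^A(ℝⁿ)`. -/
noncomputable def pdo (a : RSpace n × RSpace n → A) (ha : IsCBInfty a) :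
    𝓢(RSpace n, A) →ₗ[ℂ] 𝓢(RSpace n, A) where
  toFun u :=
    { toFun := pdoFun a u
      smooth' := isDerivClosed_pdoFun.contDiff ⟨a, u, ha, rfl⟩
      decay' := fun k m => isDerivClosed_pdoFun.iteratedFDeriv_bound
        (w := fun x => ‖x‖ ^ k) (fun x => by positivity)
        (by rintro _ ⟨a, u, ha, rfl⟩; exact pdoFun_decay ha u k) ⟨a, u, ha, rfl⟩ m }
  map_add' u v := by
    ext x
    change pdoFun a (u + v) x = pdoFun a u x + pdoFun a v x
    rw [pdoFun, pdoFun, pdoFun, ← integral_add (integrable_pdoFun_integrand ha u x)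
      (integrable_pdoFun_integrand ha v x)]
    simp [FourierTransform.fourier_add, mul_add]
  map_smul' c u := by
    ext x
    change pdoFun a (c • u) x = c • pdoFun a u x
    rw [pdoFun, pdoFun, ← integral_smul]
    refine integral_congr_ae (Eventually.of_forall fun η => ?_)
    simp only [FourierTransform.fourier_smul, smul_apply]
    rw [mul_smul_comm, smul_comm]

theorem pdo_apply (ha : IsCBInfty a) (u : 𝓢(RSpace n, A)) (x : RSpace n) :
    pdo a ha u x = pdoFun a u x := rfl

theorem pdo_mul_right (ha : IsCBInfty a) {u v : 𝓢(RSpace n, A)} {b : A}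
    (h : ∀ x, v x = u x * b) (x : RSpace n) : pdo a ha v x = pdo a ha u x * b := by
  have hF : ∀ η, 𝓕 v η = 𝓕 u η * b := fun η => by
    rw [SchwartzMap.fourier_coe, SchwartzMap.fourier_coe, fourier_eq_integral_planeWave,
      fourier_eq_integral_planeWave]
    have hi : Integrable fun y => planeWave (-y) η • u y :=
      u.integrable.norm.mono' (Continuous.aestronglyMeasurable (by fun_prop))
        (Eventually.of_forall fun y => by simp [norm_smul])
    rw [show (∫ y, planeWave (-y) η • u y) * b = (ContinuousLinearMap.mul ℝ A).flip b
      (∫ y, planeWave (-y) η • u y) from rfl, ← ContinuousLinearMap.integral_comp_comm _ hi]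
    simp [h, smul_mul_assoc]
  rw [pdo_apply, pdo_apply, pdoFun, pdoFun, show ∀ c : A, c * b =
    (ContinuousLinearMap.mul ℝ A).flip b c from fun _ => rfl,
    ← ContinuousLinearMap.integral_comp_comm _ (integrable_pdoFun_integrand ha u x)]
  simp [hF, smul_mul_assoc, mul_assoc]

end Operator

/-! ### Identification with the oscillatory integral -/

section Cutoffs

open scoped FourierTransform

variable {n : ℕ} {A : Type*} [NonUnitalCStarAlgebra A]

theorem IsCutoffSeq.tendsto_one {ψ : ℕ → RSpace n → ℂ} (hψ : IsCutoffSeq ψ) (x : RSpace n) :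
    Tendsto (fun m => ψ m x) atTop (𝓝 1) := by
  obtain ⟨r, hr, h⟩ := hψ.eq_one
  refine tendsto_const_nhds.congr' ?_
  filter_upwards [hr.eventually_gt_atTop ‖x‖] with m hm
  exact (h m x (by simpa using hm)).symm

theorem IsCutoffSeq.hasUniformTemperateGrowth {ψ : ℕ → RSpace n → ℂ} (hψ : IsCutoffSeq ψ) :
    HasUniformTemperateGrowth ψ :=
  ⟨hψ.smooth, fun j => let ⟨c, hc⟩ := hψ.bounded j; ⟨0, c, by simpa using hc⟩⟩

theorem IsCutoffSeq.exists_norm_le {ψ : ℕ → RSpace n → ℂ} (hψ : IsCutoffSeq ψ) :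
    ∃ c, ∀ m x, ‖ψ m x‖ ≤ c := by
  simpa using hψ.bounded 0

theorem integrable_one_add_norm_pow_inv :
    Integrable fun η : RSpace n => ((1 + ‖η‖) ^ (n + 1))⁻¹ := by
  have h := integrable_one_add_norm (E := RSpace n) (μ := volume) (r := ((n + 1 : ℕ) : ℝ))
    (by simp)
  refine h.congr (Eventually.of_forall fun η => ?_)
  simp only
  rw [Real.rpow_neg (by positivity), Real.rpow_natCast]

/-- The product of a cut-off function and a Schwartz function. -/
noncomputable def cutoffMul {ψ : ℕ → RSpace n → ℂ} (hψ : IsCutoffSeq ψ) (u : 𝓢(RSpace n, A))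
    (m : ℕ) : 𝓢(RSpace n, A) :=
  SchwartzMap.bilinRight (ContinuousLinearMap.lsmul ℝ ℂ)
    (hψ.hasUniformTemperateGrowth.hasTemperateGrowth m) u

theorem cutoffMul_apply {ψ : ℕ → RSpace n → ℂ} (hψ : IsCutoffSeq ψ) (u : 𝓢(RSpace n, A))
    (m : ℕ) (y : RSpace n) : cutoffMul hψ u m y = ψ m y • u y := rfl

theorem tendsto_fourier_cutoffMul {ψ : ℕ → RSpace n → ℂ} (hψ : IsCutoffSeq ψ)
    (u : 𝓢(RSpace n, A)) (η : RSpace n) :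
    Tendsto (fun m => 𝓕 (cutoffMul hψ u m) η) atTop (𝓝 (𝓕 u η)) := by
  simp only [SchwartzMap.fourier_coe, fourier_eq_integral_planeWave]
  obtain ⟨c, hc⟩ := hψ.exists_norm_le
  refine tendsto_integral_of_dominated_convergence (fun y => c * ‖u y‖) (fun m => ?_)
    (u.integrable.norm.const_mul c) (fun m => Eventually.of_forall fun y => ?_)
    (Eventually.of_forall fun y => ?_)
  · exact Continuous.aestronglyMeasurable (by fun_prop)
  · rw [norm_smul, norm_planeWave, one_mul, cutoffMul_apply, norm_smul]
    exact mul_le_mul_of_nonneg_right (hc m y) (norm_nonneg _)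
  · simp only [cutoffMul_apply]
    simpa using ((hψ.tendsto_one y).smul_const (u y)).const_smul (planeWave (-y) η)

/-- The substitution ξ = 2πη absorbs the factor (2π)^{-n}, and the inner integral over y becomes the
Fourier transform of ψ_m u. -/
theorem truncatedIntegral_eq (a : RSpace n × RSpace n → A) (u : 𝓢(RSpace n, A))
    {ψ ψ' : ℕ → RSpace n → ℂ} (hψ : IsCutoffSeq ψ) (m k : ℕ) (x : RSpace n) :
    truncatedIntegral a u (ψ m) (ψ' k) x =
      ∫ η, ψ' k ((2 * Real.pi) • η) • planeWave x η •
        (a (x, (2 * Real.pi) • η) * 𝓕 (cutoffMul hψ u m) η) := by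
  have h := Measure.integral_comp_smul (volume : Measure (RSpace n)) (fun ξ : RSpace n =>
    ∫ y : RSpace n, (Complex.exp (Complex.I * ((inner ℝ (x - y) ξ : ℝ) : ℂ)) * ψ m y * ψ' k ξ) •
      (a (x, ξ) * u y)) (2 * Real.pi)
  rw [finrank_euclideanSpace_fin, abs_of_nonneg (by positivity)] at h
  rw [truncatedIntegral, ← h]
  refine integral_congr_ae (Eventually.of_forall fun η => ?_)
  simp only
  have hi : Integrable fun y => planeWave (-y) η • cutoffMul hψ u m y :=
    (cutoffMul hψ u m).integrable.norm.mono' (Continuous.aestronglyMeasurable (by fun_prop))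
      (Eventually.of_forall fun y => by simp [norm_smul])
  let L : A →L[ℂ] A := ψ' k ((2 * Real.pi) • η) • planeWave x η •
    ContinuousLinearMap.mul ℂ A (a (x, (2 * Real.pi) • η))
  have hL : ∀ v, ψ' k ((2 * Real.pi) • η) • planeWave x η • (a (x, (2 * Real.pi) • η) * v) = L v :=
    fun v => rfl
  rw [SchwartzMap.fourier_coe, fourier_eq_integral_planeWave, hL,
    ← ContinuousLinearMap.integral_comp_comm _ hi]
  refine integral_congr_ae (Eventually.of_forall fun y => ?_)
  simp only [← hL, cutoffMul_apply, mul_smul_comm, smul_smul]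
  congr 1
  have : Complex.exp (Complex.I * ((inner ℝ (x - y) ((2 * Real.pi) • η) : ℝ) : ℂ)) =
      planeWave x η * planeWave (-y) η := by
    rw [← planeWave_add_left, planeWave, inner_smul_right, ← sub_eq_add_neg, mul_comm]
  rw [this]
  ring

/-- The symbol `(x, η) ↦ a(x, 2π η)`. -/
noncomputable def rescaleSymbol (a : RSpace n × RSpace n → A) (z : RSpace n × RSpace n) : A :=
  a (z.1, (2 * Real.pi) • z.2)

theorem IsCBInfty.rescaleSymbol {a : RSpace n × RSpace n → A} (ha : IsCBInfty a) :
    IsCBInfty (rescaleSymbol a) :=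
  ha.comp_clm ((ContinuousLinearMap.fst ℝ (RSpace n) (RSpace n)).prod
    ((2 * Real.pi) • ContinuousLinearMap.snd ℝ (RSpace n) (RSpace n)))

/-- The functions ψ_m u have uniformly bounded Schwartz seminorms, so their transforms have a common
integrable majorant of order (1 + |η|)^{-(n+1)}. Dominated convergence along the product filter then
gives the joint limit in m and k. -/
theorem isPseudoDiffOp_pdo {a : RSpace n × RSpace n → A} (ha : IsCBInfty a) :
    IsPseudoDiffOp a (pdo (rescaleSymbol a) ha.rescaleSymbol) := by
  intro u x ψ ψ' hψ hψ'
  simp only [truncatedIntegral_eq a u hψ, pdo_apply, pdoFun]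
  obtain ⟨c, hc⟩ := hψ'.exists_norm_le
  obtain ⟨C, hC⟩ := ha.bounded
  obtain ⟨D, hD⟩ := hψ.hasUniformTemperateGrowth.exists_fourier_bound
    (ContinuousLinearMap.lsmul ℝ ℂ) u (n + 1)
  have hac := ha.1.continuous
  have hψc : ∀ k, Continuous (ψ' k) := fun k => (hψ'.smooth k).continuous
  refine tendsto_integral_filter_of_dominated_convergence
    (fun η => c * (C * (D * ((1 + ‖η‖) ^ (n + 1))⁻¹)))
    (Eventually.of_forall fun p => ?_) (Eventually.of_forall fun p => Eventually.of_forall fun η => ?_)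
    (((integrable_one_add_norm_pow_inv.const_mul D).const_mul C).const_mul c)
    (Eventually.of_forall fun η => ?_)
  · exact Continuous.aestronglyMeasurable (by fun_prop)
  · rw [norm_smul]
    have hc0 : 0 ≤ c := (norm_nonneg _).trans (hc 0 0)
    have hC0 : 0 ≤ C := (norm_nonneg _).trans (hC 0)
    refine mul_le_mul (hc _ _) ?_ (norm_nonneg _) hc0
    rw [norm_smul, norm_planeWave, one_mul]
    refine (norm_mul_le _ _).trans (mul_le_mul (hC _) ?_ (norm_nonneg _) hC0)
    rw [← div_eq_mul_inv, le_div_iff₀ (by positivity), mul_comm]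
    exact hD p.1 η
  · have h1 : Tendsto (fun p : ℕ × ℕ => ψ' p.2 ((2 * Real.pi) • η)) atTop (𝓝 1) :=
      (hψ'.tendsto_one _).comp (by rw [← prod_atTop_atTop_eq]; exact tendsto_snd)
    have h2 : Tendsto (fun p : ℕ × ℕ => 𝓕 (cutoffMul hψ u p.1) η) atTop (𝓝 (𝓕 u η)) :=
      (tendsto_fourier_cutoffMul hψ u η).comp (by rw [← prod_atTop_atTop_eq]; exact tendsto_fst)
    simpa [rescaleSymbol] using h1.smul ((h2.const_mul (a (x, (2 * Real.pi) • η))).const_smul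
      (planeWave x η))

end Cutoffs

/-! ### Cauchy–Schwarz inequality for A-valued integrals -/

section CauchySchwarz

variable {A X : Type*} [NonUnitalCStarAlgebra A] [MeasurableSpace X] {μ : Measure X}

theorem integral_star_mul_self_nonneg [PartialOrder A] [StarOrderedRing A] (f : X → A) :
    0 ≤ ∫ x, star (f x) * f x ∂μ :=
  integral_nonneg fun x => star_mul_self_nonneg (f x)

/-- Expand 0 ≤ ⟨fc - g, fc - g⟩ with c = tR, R = ⟨f, g⟩ and t = (‖⟨f, f⟩‖ + ε)⁻¹. The shift by ε
covers the case ⟨f, f⟩ = 0 and is removed afterwards by letting ε tend to 0. -/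
theorem smul_star_mul_self_integral_le [PartialOrder A] [StarOrderedRing A] {f g : X → A}
    (hff : Integrable (fun x => star (f x) * f x) μ)
    (hgg : Integrable (fun x => star (g x) * g x) μ)
    (hfg : Integrable (fun x => star (f x) * g x) μ) {ε : ℝ} (hε : 0 < ε) :
    (‖∫ x, star (f x) * f x ∂μ‖ + ε)⁻¹ •
      (star (∫ x, star (f x) * g x ∂μ) * ∫ x, star (f x) * g x ∂μ) ≤
      ∫ x, star (g x) * g x ∂μ := by
  set P := ∫ x, star (f x) * f x ∂μ with hP
  set Q := ∫ x, star (g x) * g x ∂μ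
  set R := ∫ x, star (f x) * g x ∂μ with hR
  set t : ℝ := (‖P‖ + ε)⁻¹ with ht
  have htpos : 0 < t := by positivity
  let c : A := t • R
  let lm : A → A →L[ℝ] A := fun a => ContinuousLinearMap.mul ℝ A a
  let rm : A → A →L[ℝ] A := fun a => (ContinuousLinearMap.mul ℝ A).flip a
  let st : A →L[ℝ] A := (starL' ℝ : A ≃L[ℝ] A)
  have h1 : ∫ x, star c * (star (f x) * f x) * c ∂μ = star c * P * c :=
    ((rm c).comp (lm (star c))).integral_comp_comm hff
  have h1i : Integrable (fun x => star c * (star (f x) * f x) * c) μ :=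
    ((rm c).comp (lm (star c))).integrable_comp hff
  have h2 : ∫ x, star c * (star (f x) * g x) ∂μ = star c * R := (lm (star c)).integral_comp_comm hfg
  have h2i : Integrable (fun x => star c * (star (f x) * g x)) μ :=
    (lm (star c)).integrable_comp hfg
  have h3 : ∫ x, star (star (f x) * g x) * c ∂μ = star R * c :=
    ((rm c).comp st).integral_comp_comm hfg
  have h3i : Integrable (fun x => star (star (f x) * g x) * c) μ :=
    ((rm c).comp st).integrable_comp hfg
  have h4 : 0 ≤ star c * P * c - star c * R - star R * c + Q := by
    have h := integral_star_mul_self_nonneg (μ := μ) fun x => f x * c - g x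
    have he : ∀ x, star (f x * c - g x) * (f x * c - g x) =
        star c * (star (f x) * f x) * c - star c * (star (f x) * g x) -
          star (star (f x) * g x) * c + star (g x) * g x := fun x => by
      simp only [star_sub, star_mul, star_star]
      noncomm_ring
    simp only [he] at h
    rw [integral_add (by exact (h1i.sub h2i).sub h3i) hgg,
      integral_sub (by exact h1i.sub h2i) h3i,
      integral_sub h1i h2i, h1, h2, h3] at h
    exact h
  have hP0 : 0 ≤ P := integral_star_mul_self_nonneg f
  have h5 : star c * P * c ≤ ‖P‖ • (star c * c) :=
    CStarAlgebra.star_left_conjugate_le_norm_smul (IsSelfAdjoint.of_nonneg hP0)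
  -- The expansion yields the coefficient 2t - ‖P‖t², which is at least t because ‖P‖t ≤ 1.
  have h6 : t • (star R * R) ≤ (2 * t - ‖P‖ * t ^ 2) • (star R * R) := by
    refine smul_le_smul_of_nonneg_right ?_ (star_mul_self_nonneg R)
    have h7 : ‖P‖ * t ≤ 1 := by
      rw [ht, ← div_eq_mul_inv, div_le_one (by positivity)]; linarith
    nlinarith
  have h8 : star c * P * c - star c * R - star R * c + Q ≤
      ‖P‖ • (star c * c) - star c * R - star R * c + Q := by gcongr
  have h9 : ‖P‖ • (star c * c) - star c * R - star R * c + Q =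
      Q - (2 * t - ‖P‖ * t ^ 2) • (star R * R) := by
    simp only [c, star_smul, star_trivial, smul_mul_assoc, mul_smul_comm, smul_smul, sub_smul]
    module
  exact h6.trans (sub_nonneg.1 (h9 ▸ h4.trans h8))

theorem norm_integral_star_mul_sq_le {f g : X → A}
    (hff : Integrable (fun x => star (f x) * f x) μ)
    (hgg : Integrable (fun x => star (g x) * g x) μ)
    (hfg : Integrable (fun x => star (f x) * g x) μ) :
    ‖∫ x, star (f x) * g x ∂μ‖ ^ 2 ≤ ‖∫ x, star (f x) * f x ∂μ‖ * ‖∫ x, star (g x) * g x ∂μ‖ := by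
  let _ : PartialOrder A := CStarAlgebra.spectralOrder A
  let _ : StarOrderedRing A := CStarAlgebra.spectralOrderedRing A
  set Q := ‖∫ x, star (g x) * g x ∂μ‖
  set P := ‖∫ x, star (f x) * f x ∂μ‖ with hP
  have key : ∀ ε > 0, ‖∫ x, star (f x) * g x ∂μ‖ ^ 2 ≤ (P + ε) * Q := fun ε hε => by
    have h := CStarAlgebra.norm_le_norm_of_nonneg_of_le
      (smul_nonneg (by positivity) (star_mul_self_nonneg _))
      (smul_star_mul_self_integral_le hff hgg hfg hε)
    rw [norm_smul, CStarRing.norm_star_mul_self, ← sq, Real.norm_of_nonneg (by positivity),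
      inv_mul_le_iff₀ (by positivity)] at h
    exact h
  have hlim : Tendsto (fun ε : ℝ => (P + ε) * Q) (𝓝[>] 0) (𝓝 ((P + 0) * Q)) :=
    ((tendsto_const_nhds.add tendsto_id).mul_const Q).mono_left nhdsWithin_le_nhds
  rw [add_zero] at hlim
  exact ge_of_tendsto hlim (eventually_nhdsWithin_of_forall key)

theorem norm_integral_star_mul_mul_self_le {b Y : X → A} {M : ℝ} (hM : ∀ x, ‖b x‖ ≤ M)
    (hbY : Integrable (fun x => star (b x * Y x) * (b x * Y x)) μ)
    (hY : Integrable (fun x => star (Y x) * Y x) μ) :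
    ‖∫ x, star (b x * Y x) * (b x * Y x) ∂μ‖ ≤ M ^ 2 * ‖∫ x, star (Y x) * Y x ∂μ‖ := by
  let _ : PartialOrder A := CStarAlgebra.spectralOrder A
  let _ : StarOrderedRing A := CStarAlgebra.spectralOrderedRing A
  have h : ∫ x, star (b x * Y x) * (b x * Y x) ∂μ ≤ ∫ x, M ^ 2 • (star (Y x) * Y x) ∂μ := by
    refine integral_mono hbY (hY.smul _) fun x => ?_
    have h1 : star (Y x) * (star (b x) * b x) * Y x ≤ ‖star (b x) * b x‖ • (star (Y x) * Y x) :=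
      CStarAlgebra.star_left_conjugate_le_norm_smul (IsSelfAdjoint.star_mul_self _)
    calc star (b x * Y x) * (b x * Y x) = star (Y x) * (star (b x) * b x) * Y x := by
          simp only [star_mul, mul_assoc]
      _ ≤ ‖star (b x) * b x‖ • (star (Y x) * Y x) := h1
      _ ≤ M ^ 2 • (star (Y x) * Y x) := by
          refine smul_le_smul_of_nonneg_right ?_ (star_mul_self_nonneg _)
          rw [CStarRing.norm_star_mul_self, ← sq]
          exact pow_le_pow_left₀ (norm_nonneg _) (hM x) 2
  have h2 := CStarAlgebra.norm_le_norm_of_nonneg_of_le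
    (integral_star_mul_self_nonneg fun x => b x * Y x) h
  rwa [integral_smul, norm_smul, Real.norm_of_nonneg (by positivity)] at h2

/-- Cauchy–Schwarz is applied to H* and bY, so the left factor contributes ∫ HH* rather than ∫ H*H.
The middle factor b is then removed by (bY)*(bY) ≤ M² Y*Y. -/
theorem norm_integral_mul_mul_le {H b Y : X → A} {M : ℝ} (hM0 : 0 ≤ M) (hM : ∀ x, ‖b x‖ ≤ M)
    (hH : Integrable (fun x => H x * star (H x)) μ)
    (hbY : Integrable (fun x => star (b x * Y x) * (b x * Y x)) μ)
    (hY : Integrable (fun x => star (Y x) * Y x) μ)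
    (hHY : Integrable (fun x => H x * (b x * Y x)) μ) :
    ‖∫ x, H x * (b x * Y x) ∂μ‖ ≤
      M * √‖∫ x, H x * star (H x) ∂μ‖ * √‖∫ x, star (Y x) * Y x ∂μ‖ := by
  have h1 := norm_integral_star_mul_sq_le (f := fun x => star (H x)) (g := fun x => b x * Y x)
    (by simpa using hH) hbY (by simpa using hHY)
  simp only [star_star] at h1
  have h2 := norm_integral_star_mul_mul_self_le hM hbY hY
  refine abs_le_of_sq_le_sq' ?_ (by positivity) |>.2
  rw [mul_pow, mul_pow, Real.sq_sqrt (norm_nonneg _), Real.sq_sqrt (norm_nonneg _)]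
  refine h1.trans ((mul_le_mul_of_nonneg_left h2 (norm_nonneg _)).trans_eq (by ring))

end CauchySchwarz

/-! ### Weights and windows -/

section Windows

variable {n : ℕ}

/-- The weight `∏ⱼ (1 + tⱼ²)^{1/2}`. -/
noncomputable def windowWeight (t : RSpace n) : ℝ := ∏ i, √(1 + t i ^ 2)

theorem one_le_windowWeight (t : RSpace n) : 1 ≤ windowWeight t :=
  Finset.one_le_prod fun i _ => Real.one_le_sqrt.2 (by nlinarith [sq_nonneg (t i)])

theorem windowWeight_pos (t : RSpace n) : 0 < windowWeight t :=
  one_pos.trans_le (one_le_windowWeight t)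

theorem windowWeight_le (t : RSpace n) : windowWeight t ≤ (1 + ‖t‖) ^ n := by
  have h : ∀ i ∈ (Finset.univ : Finset (Fin n)), √(1 + t i ^ 2) ≤ 1 + ‖t‖ := fun i _ => by
    have h1 : |t i| ≤ ‖t‖ := PiLp.norm_apply_le t i
    rw [Real.sqrt_le_left (by positivity)]
    nlinarith [sq_abs (t i), abs_nonneg (t i), norm_nonneg t]
  simpa [windowWeight] using Finset.prod_le_prod (fun i _ => Real.sqrt_nonneg _) h

/-- A Peetre inequality, coordinatewise: 2(1 + y²)(1 + (y - x)²) - (1 + x²) = 1 + (2y - x)² + 2y²(y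
- x)² ≥ 0. -/
theorem windowWeight_le_mul (x y : RSpace n) :
    windowWeight x ≤ √2 ^ n * (windowWeight y * windowWeight (y - x)) := by
  have h : ∀ i ∈ (Finset.univ : Finset (Fin n)),
      √(1 + x i ^ 2) ≤ √2 * (√(1 + y i ^ 2) * √(1 + (y - x) i ^ 2)) := fun i _ => by
    rw [← Real.sqrt_mul (by positivity), ← Real.sqrt_mul (by positivity)]
    refine Real.sqrt_le_sqrt ?_
    simp only [PiLp.sub_apply]
    nlinarith [sq_nonneg (2 * y i - x i), sq_nonneg (y i * (y i - x i))]
  simpa [windowWeight, Finset.prod_mul_distrib] using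
    Finset.prod_le_prod (fun i _ => Real.sqrt_nonneg _) h

theorem integrable_windowWeight_sq_inv :
    Integrable fun t : RSpace n => (windowWeight t ^ 2)⁻¹ := by
  have h : Integrable fun t : Fin n → ℝ => ∏ i, (1 + t i ^ 2)⁻¹ :=
    Integrable.fintype_prod (f := fun _ s => (1 + s ^ 2)⁻¹) fun _ => integrable_inv_one_add_sq
  have h2 := (PiLp.volume_preserving_ofLp (Fin n)).integrable_comp_of_integrable h
  refine h2.congr (Eventually.of_forall fun t => ?_)
  simp only [Function.comp_apply, windowWeight, ← Finset.prod_pow, ← Finset.prod_inv_distrib]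
  exact Finset.prod_congr rfl fun i _ => by rw [Real.sq_sqrt (by positivity)]

/-- A smooth function that decays, with all its derivatives, like the inverse of the weight. -/
def IsWindow (h : RSpace n → ℂ) : Prop :=
  ContDiff ℝ ∞ h ∧ ∀ m : ℕ, ∃ C, ∀ t, windowWeight t * ‖iteratedFDeriv ℝ m h t‖ ≤ C

variable {h : RSpace n → ℂ}

theorem IsWindow.isCBInfty (hh : IsWindow h) : IsCBInfty h := by
  refine ⟨hh.1, fun m => ?_⟩
  obtain ⟨C, hC⟩ := hh.2 m
  exact ⟨C, fun t => (le_mul_of_one_le_left (norm_nonneg _) (one_le_windowWeight t)).trans (hC t)⟩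

theorem IsWindow.lineDeriv (hh : IsWindow h) (v : RSpace n) :
    IsWindow fun t => lineDeriv ℝ h t v := by
  refine ⟨(hh.isCBInfty.lineDeriv v).1, fun m => ?_⟩
  obtain ⟨C, hC⟩ := hh.2 (m + 1)
  have he : (fun z => _root_.lineDeriv ℝ h z v) =
      fun z => ContinuousLinearMap.apply ℝ ℂ v (_root_.fderiv ℝ h z) :=
    funext fun z => (hh.isCBInfty.differentiable z).lineDeriv_eq_fderiv
  refine ⟨‖ContinuousLinearMap.apply ℝ ℂ v‖ * C, fun t => ?_⟩
  have h1 := (ContinuousLinearMap.apply ℝ ℂ v).norm_iteratedFDeriv_comp_left (n := m)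
    (f := _root_.fderiv ℝ h) (x := t)
    (hh.isCBInfty.fderiv.1.of_le (by exact_mod_cast le_top)).contDiffAt le_rfl
  rw [norm_iteratedFDeriv_fderiv] at h1
  rw [he]
  calc windowWeight t * _ ≤ windowWeight t * (‖ContinuousLinearMap.apply ℝ ℂ v‖ *
        ‖iteratedFDeriv ℝ (m + 1) h t‖) := mul_le_mul_of_nonneg_left h1 (windowWeight_pos t).le
    _ = ‖ContinuousLinearMap.apply ℝ ℂ v‖ * (windowWeight t * ‖iteratedFDeriv ℝ (m + 1) h t‖) := by
        ring
    _ ≤ _ := mul_le_mul_of_nonneg_left (hC t) (norm_nonneg (ContinuousLinearMap.apply ℝ ℂ v))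

theorem IsWindow.integrable_norm_sq (hh : IsWindow h) : Integrable fun t => ‖h t‖ ^ 2 := by
  obtain ⟨C, hC⟩ := hh.2 0
  have hc := hh.1.continuous
  refine (integrable_windowWeight_sq_inv.const_mul (C ^ 2)).mono'
    (Continuous.aestronglyMeasurable (by fun_prop)) (Eventually.of_forall fun t => ?_)
  have := hC t
  rw [norm_iteratedFDeriv_zero] at this
  rw [Real.norm_of_nonneg (by positivity), ← div_eq_mul_inv,
    le_div_iff₀ (by have := windowWeight_pos t; positivity), ← mul_pow, mul_comm]
  exact pow_le_pow_left₀ (mul_nonneg (windowWeight_pos t).le (norm_nonneg _)) this 2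

/-- The function `s ↦ (1 - 2π i s)⁻¹`. -/
noncomputable def simpleWindow (s : ℝ) : ℂ := (1 - 2 * Real.pi * Complex.I * s)⁻¹

theorem one_sub_mul_I_ne_zero (s : ℝ) : (1 - 2 * Real.pi * Complex.I * s : ℂ) ≠ 0 := fun h => by
  simpa using congrArg Complex.re h

theorem norm_simpleWindow_le (s : ℝ) : ‖simpleWindow s‖ ≤ (√(1 + s ^ 2))⁻¹ := by
  rw [simpleWindow, norm_inv]
  refine inv_anti₀ (by positivity) ?_
  rw [Complex.norm_eq_sqrt_sq_add_sq]
  refine Real.sqrt_le_sqrt ?_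
  have : 1 ≤ (2 * Real.pi) ^ 2 := by nlinarith [Real.pi_gt_three]
  simp only [Complex.sub_re, Complex.sub_im, Complex.mul_re, Complex.mul_im, Complex.one_re,
    Complex.one_im, Complex.I_re, Complex.I_im, Complex.ofReal_re, Complex.ofReal_im,
    Complex.re_ofNat, Complex.im_ofNat]
  nlinarith [mul_nonneg (sub_nonneg.2 this) (sq_nonneg s)]

theorem norm_simpleWindow_le_one (s : ℝ) : ‖simpleWindow s‖ ≤ 1 :=
  (norm_simpleWindow_le s).trans (inv_le_one_of_one_le₀ (Real.one_le_sqrt.2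
    (by nlinarith [sq_nonneg s])))

theorem hasDerivAt_simpleWindow (s : ℝ) :
    HasDerivAt simpleWindow (2 * Real.pi * Complex.I * simpleWindow s ^ 2) s := by
  have h1 : HasDerivAt (fun s : ℝ => (1 - 2 * Real.pi * Complex.I * s : ℂ))
      (-(2 * Real.pi * Complex.I)) s := by
    simpa using ((hasDerivAt_id s).ofReal_comp.const_mul (2 * Real.pi * Complex.I)).const_sub 1
  have h2 := h1.inv (one_sub_mul_I_ne_zero s)
  refine h2.congr_deriv ?_
  rw [simpleWindow, neg_neg, inv_pow, div_eq_mul_inv]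

theorem hasFDerivAt_prod_simpleWindow_pow (c : ℂ) (r : Fin n → ℕ) (t : RSpace n) :
    HasFDerivAt (fun t : RSpace n => c * ∏ i, simpleWindow (t i) ^ (r i + 1))
      (∑ j, (EuclideanSpace.proj j : RSpace n →L[ℝ] ℝ).smulRight
        (c * ((r j + 1 : ℕ) * (2 * Real.pi * Complex.I)) *
          ∏ i, simpleWindow (t i) ^ ((r + Pi.single j 1 : Fin n → ℕ) i + 1))) t := by
  have h1 : ∀ i ∈ (Finset.univ : Finset (Fin n)),
      HasFDerivAt (fun t : RSpace n => simpleWindow (t i) ^ (r i + 1))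
        ((EuclideanSpace.proj i : RSpace n →L[ℝ] ℝ).smulRight
          ((r i + 1 : ℕ) * (2 * Real.pi * Complex.I) * simpleWindow (t i) ^ (r i + 2))) t := by
    intro i _
    have h3 := HasFDerivAt.comp (f := fun t : RSpace n => t i) t
      ((hasDerivAt_simpleWindow (t i)).fun_pow (r i + 1)).hasFDerivAt
      (EuclideanSpace.proj i : RSpace n →L[ℝ] ℝ).hasFDerivAt
    refine h3.congr_fderiv ?_
    ext v
    simp
    left
    ring
  have h2 := (HasFDerivAt.finsetProd h1).const_mul c
  refine h2.congr_fderiv ?_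
  rw [Finset.smul_sum]
  refine Finset.sum_congr rfl fun j _ => ?_
  have h4 : ∏ i, simpleWindow (t i) ^ ((r + Pi.single j 1 : Fin n → ℕ) i + 1) =
      (∏ i ∈ Finset.univ.erase j, simpleWindow (t i) ^ (r i + 1)) *
        simpleWindow (t j) ^ (r j + 2) := by
    rw [← Finset.prod_erase_mul _ _ (Finset.mem_univ j)]
    congr 1
    · refine Finset.prod_congr rfl fun i hi => ?_
      simp [Finset.ne_of_mem_erase hi]
    · simp
  rw [h4]
  ext v
  simp
  ring

/-- The window `t ↦ ∏ⱼ (1 - 2π i tⱼ)⁻¹`. -/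
noncomputable def prodWindow (t : RSpace n) : ℂ := ∏ i, simpleWindow (t i)

theorem isDerivClosed_prod_simpleWindow_pow :
    IsDerivClosed {f : RSpace n → ℂ | ∃ (c : ℂ) (r : Fin n → ℕ),
      f = fun t => c * ∏ i, simpleWindow (t i) ^ (r i + 1)} := by
  rintro _ ⟨c, r, rfl⟩
  exact ⟨Fin n, inferInstance, _, _, fun j => ⟨_, r + Pi.single j 1, rfl⟩,
    hasFDerivAt_prod_simpleWindow_pow c r⟩

/-- The derivative of (1 - 2πi s)⁻¹ is 2πi times its square, so all derivatives are multiples of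
products of positive powers of the factors. One power of each factor pays for the weight and the
remaining ones are at most 1 in norm. -/
theorem isWindow_prodWindow : IsWindow (prodWindow : RSpace n → ℂ) := by
  have hmem : (prodWindow : RSpace n → ℂ) ∈ {f : RSpace n → ℂ | ∃ (c : ℂ) (r : Fin n → ℕ),
      f = fun t => c * ∏ i, simpleWindow (t i) ^ (r i + 1)} :=
    ⟨1, 0, funext fun t => by simp [prodWindow]⟩
  refine ⟨isDerivClosed_prod_simpleWindow_pow.contDiff hmem, fun m =>
    isDerivClosed_prod_simpleWindow_pow.iteratedFDeriv_bound (fun t => (windowWeight_pos t).le)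
      ?_ hmem m⟩
  rintro _ ⟨c, r, rfl⟩
  refine ⟨‖c‖, fun t => ?_⟩
  rw [norm_mul, norm_prod, mul_left_comm, windowWeight, ← Finset.prod_mul_distrib]
  refine mul_le_of_le_one_right (norm_nonneg _) (Finset.prod_le_one (fun i _ => by positivity)
    fun i _ => ?_)
  rw [norm_pow, pow_succ ‖_‖]
  have h1 := norm_simpleWindow_le (t i)
  have h2 : ‖simpleWindow (t i)‖ ^ r i ≤ 1 :=
    pow_le_one₀ (norm_nonneg _) (norm_simpleWindow_le_one _)
  calc √(1 + t i ^ 2) * (‖simpleWindow (t i)‖ ^ r i * ‖simpleWindow (t i)‖)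
      ≤ √(1 + t i ^ 2) * (1 * (√(1 + t i ^ 2))⁻¹) := by gcongr
    _ = 1 := by rw [one_mul, mul_inv_cancel₀ (by positivity)]

/-- The Peetre inequality trades the weight at the centre x for the weight at y - x, absorbed by the
window, and the weight at y, which grows polynomially in the integration variable. -/
theorem IsWindow.hasUniformTemperateGrowth (hh : IsWindow h) :
    HasUniformTemperateGrowth fun x y : RSpace n => windowWeight x • h (y - x) := by
  have hcd : ∀ x : RSpace n, ContDiff ℝ ∞ fun y => h (y - x) := fun x =>
    hh.1.comp (contDiff_id.sub contDiff_const)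
  refine ⟨fun x => contDiff_const.fun_smul (hcd x), fun j => ?_⟩
  obtain ⟨C, hC⟩ := hh.2 j
  refine ⟨n, √2 ^ n * C, fun x y => ?_⟩
  rw [iteratedFDeriv_const_smul_apply' ((hcd x).of_le (by exact_mod_cast le_top)).contDiffAt,
    iteratedFDeriv_comp_sub, norm_smul, Real.norm_of_nonneg (windowWeight_pos x).le]
  calc windowWeight x * ‖iteratedFDeriv ℝ j h (y - x)‖
      ≤ √2 ^ n * (windowWeight y * windowWeight (y - x)) * ‖iteratedFDeriv ℝ j h (y - x)‖ :=
        mul_le_mul_of_nonneg_right (windowWeight_le_mul x y) (norm_nonneg _)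
    _ = √2 ^ n * (windowWeight y * (windowWeight (y - x) * ‖iteratedFDeriv ℝ j h (y - x)‖)) := by
        ring
    _ ≤ √2 ^ n * ((1 + ‖y‖) ^ n * C) := by
        refine mul_le_mul_of_nonneg_left ?_ (by positivity)
        exact mul_le_mul (windowWeight_le y) (hC _)
          (mul_nonneg (windowWeight_pos _).le (norm_nonneg _)) (by positivity)
    _ = _ := by ring

end Windows

/-! ### The short-time Fourier transform -/

section STFT

open scoped FourierTransform Convolution

variable {n : ℕ} {A : Type*} [NonUnitalCStarAlgebra A] {h : RSpace n → ℂ}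

/-- The short-time Fourier transform `∫ e^{-2π i y·η} h(y - x) u(y) dy`. -/
noncomputable def stft (h : RSpace n → ℂ) (u : 𝓢(RSpace n, A)) (x η : RSpace n) : A :=
  ∫ y, planeWave (-y) η • (h (y - x) • u y)

theorem IsWindow.hasTemperateGrowth_sub (hh : IsWindow h) (x : RSpace n) :
    (fun y => h (y - x)).HasTemperateGrowth := by
  have := (hh.isCBInfty.comp_const_add (-x)).hasTemperateGrowth
  simpa only [neg_add_eq_sub] using this

theorem stft_eq_fourier (hh : IsWindow h) (u : 𝓢(RSpace n, A)) (x η : RSpace n) :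
    stft h u x η = 𝓕 (SchwartzMap.bilinRight (ContinuousLinearMap.lsmul ℝ ℂ)
      (hh.hasTemperateGrowth_sub x) u) η := by
  rw [SchwartzMap.fourier_coe, fourier_eq_integral_planeWave]
  rfl

theorem IsWindow.exists_norm_le (hh : IsWindow h) : ∃ C, 0 ≤ C ∧ ∀ t, ‖h t‖ ≤ C := by
  obtain ⟨C, hC⟩ := hh.isCBInfty.bounded
  exact ⟨C, (norm_nonneg _).trans (hC 0), hC⟩

theorem norm_stft_integrand_le {C : ℝ} (hC : ∀ t, ‖h t‖ ≤ C) (v : A) (x y η : RSpace n) :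
    ‖planeWave (-y) η • (h (y - x) • v)‖ ≤ C * ‖v‖ := by
  rw [norm_smul, norm_planeWave, one_mul, norm_smul]
  exact mul_le_mul_of_nonneg_right (hC _) (norm_nonneg _)

theorem IsWindow.continuous_stft (hh : IsWindow h) (u : 𝓢(RSpace n, A)) :
    Continuous fun z : RSpace n × RSpace n => stft h u z.1 z.2 := by
  obtain ⟨C, -, hC⟩ := hh.exists_norm_le
  have hc := hh.1.continuous
  refine continuous_of_dominated (bound := fun y => C * ‖u y‖)
    (fun z => Continuous.aestronglyMeasurable (by fun_prop))
    (fun z => Eventually.of_forall fun y => norm_stft_integrand_le hC _ _ _ _)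
    (u.integrable.norm.const_mul C) (Eventually.of_forall fun y => by fun_prop)

/-- Multiplying the window by the weight at x keeps temperate growth uniform, so the weighted
transform decays rapidly in η uniformly in x. The resulting decay in x is square integrable. -/
theorem IsWindow.exists_stft_bound (hh : IsWindow h) (u : 𝓢(RSpace n, A)) :
    ∃ C, 0 ≤ C ∧ ∀ x η, ‖stft h u x η‖ ≤ C * ((windowWeight x)⁻¹ * ((1 + ‖η‖) ^ (n + 1))⁻¹) := by
  obtain ⟨C, hC⟩ := hh.hasUniformTemperateGrowth.exists_fourier_bound
    (ContinuousLinearMap.lsmul ℝ ℂ) u (n + 1)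
  refine ⟨C, le_trans (by positivity) (hC 0 0), fun x η => ?_⟩
  have h1 : 𝓕 (SchwartzMap.bilinRight (ContinuousLinearMap.lsmul ℝ ℂ)
      (hh.hasUniformTemperateGrowth.hasTemperateGrowth x) u) η =
      windowWeight x • stft h u x η := by
    rw [SchwartzMap.fourier_coe, fourier_eq_integral_planeWave, stft, ← integral_smul]
    refine integral_congr_ae (Eventually.of_forall fun y => ?_)
    simp only [SchwartzMap.bilinRight_apply, ContinuousLinearMap.lsmul_apply]
    rw [smul_assoc, smul_comm]
  have h2 := hC x η
  rw [h1, norm_smul, Real.norm_of_nonneg (windowWeight_pos x).le] at h2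
  have hw := windowWeight_pos x
  rw [← mul_inv, ← div_eq_mul_inv, le_div_iff₀ (by positivity)]
  calc _ = (1 + ‖η‖) ^ (n + 1) * (windowWeight x * ‖stft h u x η‖) := by ring
    _ ≤ C := h2

theorem IsWindow.hasFDerivAt_stft (hh : IsWindow h) (u : 𝓢(RSpace n, A)) (η x : RSpace n) :
    HasFDerivAt (fun x => stft h u x η)
      (∑ i, (-(EuclideanSpace.proj i : RSpace n →L[ℝ] ℝ)).smulRight
        (stft (fun t => _root_.lineDeriv ℝ h t (stdVec i)) u x η)) x := by
  obtain ⟨C, -, hC⟩ := hh.exists_norm_le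
  choose D _ hD using fun i : Fin n => (hh.lineDeriv (stdVec i)).exists_norm_le
  have hc := hh.1.continuous
  have hc' := fun i : Fin n => (hh.lineDeriv (stdVec i)).1.continuous
  refine hasFDerivAt_integral_sum_smulRight
    (L := fun i => -(EuclideanSpace.proj i : RSpace n →L[ℝ] ℝ))
    (f := fun x y => planeWave (-y) η • (h (y - x) • u y))
    (g := fun i x y => planeWave (-y) η • (_root_.lineDeriv ℝ h (y - x) (stdVec i) • u y))
    (bf := fun y => C * ‖u y‖) (bg := fun i y => D i * ‖u y‖)
    (fun x => Continuous.aestronglyMeasurable (by fun_prop))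
    (fun i x => Continuous.aestronglyMeasurable ?_)
    (fun x y => norm_stft_integrand_le hC _ _ _ _)
    (fun i x y => norm_stft_integrand_le (hD i) _ _ _ _)
    (u.integrable.norm.const_mul C) (fun i => u.integrable.norm.const_mul _) ?_ x
  · have := (hc' i).comp (continuous_id.sub (continuous_const (y := x)))
    exact (continuous_planeWave (by fun_prop) (by fun_prop)).smul (this.smul u.continuous)
  · intro x y
    have h1 := hasFDerivAt_of_differentiableAt (hh.isCBInfty.differentiable (y - x))
    have h2 : HasFDerivAt (fun x => y - x) (-ContinuousLinearMap.id ℝ (RSpace n)) x :=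
      (hasFDerivAt_id x).const_sub y
    have h3 := ((h1.comp x h2).smul_const (u y)).const_smul (planeWave (-y) η)
    refine h3.congr_fderiv ?_
    ext v
    simp only [sum_apply, smul_apply, ContinuousLinearMap.smulRight_apply,
      ContinuousLinearMap.comp_apply, neg_apply, ContinuousLinearMap.id_apply, map_neg]
    rw [neg_smul, smul_neg, Finset.sum_smul, Finset.smul_sum, ← Finset.sum_neg_distrib]
    refine Finset.sum_congr rfl fun i _ => ?_
    rw [smul_assoc, smul_comm, neg_smul]

theorem isDerivClosed_stft (u : 𝓢(RSpace n, A)) (η : RSpace n) :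
    IsDerivClosed {f : RSpace n → A | ∃ h, IsWindow h ∧ f = fun x => stft h u x η} := by
  rintro _ ⟨h, hh, rfl⟩
  exact ⟨Fin n, inferInstance, _, _, fun i => ⟨_, hh.lineDeriv (stdVec i), rfl⟩,
    hh.hasFDerivAt_stft u η⟩

/-- An x-derivative only replaces the window by minus its derivative, so transforms with arbitrary
windows form a class closed under differentiation; each is bounded since u is integrable. This makes
integration by parts in x legitimate. -/
theorem IsWindow.isCBInfty_stft (hh : IsWindow h) (u : 𝓢(RSpace n, A)) (η : RSpace n) :
    IsCBInfty fun x => stft h u x η := by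
  refine (isDerivClosed_stft u η).isCBInfty ?_ ⟨h, hh, rfl⟩
  rintro _ ⟨h, hh, rfl⟩
  obtain ⟨C, -, hC⟩ := hh.exists_norm_le
  exact ⟨_, fun x => norm_integral_le_of_norm_le (u.integrable.norm.const_mul C)
    (Eventually.of_forall fun y => norm_stft_integrand_le hC _ _ _ _)⟩

theorem IsWindow.hasLineDerivAt_stft (hh : IsWindow h) (u : 𝓢(RSpace n, A)) (η x : RSpace n)
    (j : Fin n) : HasLineDerivAt ℝ (fun x => stft h u x η)
      (-stft (fun t => _root_.lineDeriv ℝ h t (stdVec j)) u x η) x (stdVec j) := by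
  have := (hh.hasFDerivAt_stft u η x).hasLineDerivAt (stdVec j)
  rw [sum_apply, Finset.sum_eq_single j] at this
  · simpa [stdVec] using this
  · intro i _ hij
    simp [stdVec, hij]
  · simp

theorem integrable_prod_of_norm_le {F : Type*} [NormedAddCommGroup F]
    {Φ : RSpace n × RSpace n → F} (hΦ : Continuous Φ) {f g : RSpace n → ℝ} (hf : Integrable f)
    (hg : Integrable g) (C : ℝ) (hle : ∀ x η, ‖Φ (x, η)‖ ≤ C * (f x * g η)) : Integrable Φ :=
  ((hf.mul_prod hg).const_mul C).mono' hΦ.aestronglyMeasurable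
    (Eventually.of_forall fun z => hle z.1 z.2)

variable {B : Type*} [NormedAddCommGroup B] [NormedSpace ℂ B]

theorem IsWindow.integrable_sesq_stft (hh : IsWindow h) (u : 𝓢(RSpace n, A))
    (M : A →L⋆[ℂ] A →L[ℂ] B) :
    Integrable fun z : RSpace n × RSpace n => M (stft h u z.1 z.2) (stft h u z.1 z.2) := by
  obtain ⟨C, hC0, hC⟩ := hh.exists_stft_bound u
  have hc := hh.continuous_stft u
  refine integrable_prod_of_norm_le ((M.continuous.comp hc).clm_apply hc)
    integrable_windowWeight_sq_inv
    integrable_one_add_norm_pow_inv (‖M‖ * C ^ 2) fun x η => ?_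
  refine (M.le_opNorm₂ _ _).trans ?_
  have hw := windowWeight_pos x
  -- The η-decay of one factor suffices; both factors are needed for integrability in x.
  have h1 : ((1 + ‖η‖) ^ (n + 1))⁻¹ ≤ 1 :=
    inv_le_one_of_one_le₀ (one_le_pow₀ (by simp))
  calc ‖M‖ * ‖stft h u x η‖ * ‖stft h u x η‖
      ≤ ‖M‖ * (C * ((windowWeight x)⁻¹ * ((1 + ‖η‖) ^ (n + 1))⁻¹)) *
          (C * ((windowWeight x)⁻¹ * 1)) := by
        have := hC x η
        gcongr
        exact this.trans (by gcongr)
    _ = _ := by ring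

/-- Orthogonality relations for the short-time Fourier transform. -/
theorem IsWindow.integral_sesq_stft [CompleteSpace B] (hh : IsWindow h) (u : 𝓢(RSpace n, A))
    (M : A →L⋆[ℂ] A →L[ℂ] B) :
    ∫ z : RSpace n × RSpace n, M (stft h u z.1 z.2) (stft h u z.1 z.2) =
      (∫ t, ‖h t‖ ^ 2) • ∫ y, M (u y) (u y) := by
  have hMu : Integrable fun y => M (u y) (u y) := by
    obtain ⟨C, -, hC⟩ := u.exists_one_add_pow_mul_le 0 0
    refine (u.integrable.norm.const_mul (‖M‖ * C)).mono'
      ((M.continuous.comp u.continuous).clm_apply u.continuous).aestronglyMeasurable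
      (Eventually.of_forall fun y => (M.le_opNorm₂ _ _).trans ?_)
    have : ‖u y‖ ≤ C := by simpa using hC y
    gcongr
  -- Plancherel in η at fixed x gives ∫ |h(y - x)|² M(u(y), u(y)) dy, a convolution in x; its
  -- integral is the product of the integrals.
  have h1 : ∀ x, ∫ η, M (stft h u x η) (stft h u x η) =
      ((fun y => M (u y) (u y)) ⋆[(ContinuousLinearMap.lsmul ℝ ℝ : ℝ →L[ℝ] B →L[ℝ] B).flip]
        fun t => ‖h (-t)‖ ^ 2) x := fun x => by
    simp only [stft_eq_fourier hh]
    rw [SchwartzMap.integral_sesq_fourier_fourier, convolution_def]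
    refine integral_congr_ae (Eventually.of_forall fun y => ?_)
    simp only [SchwartzMap.bilinRight_apply, ContinuousLinearMap.lsmul_apply,
      ContinuousLinearMap.flip_apply, map_smulₛₗ, smul_apply, neg_sub, smul_smul]
    rw [RingHom.id_apply, RCLike.mul_conj, ← Complex.coe_smul]
    simp
  rw [Measure.volume_eq_prod, integral_prod _ (hh.integrable_sesq_stft u M)]
  simp only [h1]
  rw [integral_convolution _ hMu hh.integrable_norm_sq.comp_neg]
  simp only [ContinuousLinearMap.flip_apply, ContinuousLinearMap.lsmul_apply]
  rw [integral_neg_eq_self (fun t => ‖h t‖ ^ 2)]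

end STFT

/-! ### The operators 1 - ∂ on bounded smooth functions -/

section OneSubDeriv

variable {V F : Type*} [NormedAddCommGroup V] [NormedSpace ℝ V]
  [NormedAddCommGroup F] [NormedSpace ℝ F]

/-- The composition of the operators `1 - ∂_v`, for `v` in a list; the head of the list acts
first. -/
noncomputable def oneSubDeriv : List V → CBSpace V F →ₗ[ℝ] CBSpace V F
  | [] => LinearMap.id
  | v :: l => oneSubDeriv l ∘ₗ (LinearMap.id - CBSpace.deriv v)

theorem oneSubDeriv_nil (f : CBSpace V F) : oneSubDeriv [] f = f := rfl

theorem oneSubDeriv_cons (v : V) (l : List V) (f : CBSpace V F) :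
    oneSubDeriv (v :: l) f = oneSubDeriv l (f - CBSpace.deriv v f) := rfl

/-- All iterated derivatives along sublists of the list `l` are bounded by `M`. -/
def SublistDerivsBdd : List V → ℝ → CBSpace V F → Prop
  | [], M, f => ∀ z, ‖(f : V → F) z‖ ≤ M
  | v :: l, M, f => SublistDerivsBdd l M f ∧ SublistDerivsBdd l M (CBSpace.deriv v f)

theorem SublistDerivsBdd.sub {l : List V} {M M' : ℝ} {f g : CBSpace V F}
    (hf : SublistDerivsBdd l M f) (hg : SublistDerivsBdd l M' g) :
    SublistDerivsBdd l (M + M') (f - g) := by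
  induction l generalizing f g with
  | nil => exact fun z => (norm_sub_le _ _).trans (add_le_add (hf z) (hg z))
  | cons v l ih => exact ⟨ih hf.1 hg.1, by rw [map_sub]; exact ih hf.2 hg.2⟩

theorem SublistDerivsBdd.mono {l : List V} {M M' : ℝ} (hM : M ≤ M') {f : CBSpace V F}
    (hf : SublistDerivsBdd l M f) : SublistDerivsBdd l M' f := by
  induction l generalizing f with
  | nil => exact fun z => (hf z).trans hM
  | cons v l ih => exact ⟨ih hf.1, ih hf.2⟩

theorem SublistDerivsBdd.smul {l : List V} {M : ℝ} {f : CBSpace V F} (c : ℝ)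
    (hf : SublistDerivsBdd l M f) : SublistDerivsBdd l (|c| * M) (c • f) := by
  induction l generalizing f with
  | nil =>
    intro z
    rw [Submodule.coe_smul, Pi.smul_apply, norm_smul, Real.norm_eq_abs]
    exact mul_le_mul_of_nonneg_left (hf z) (abs_nonneg c)
  | cons v l ih => exact ⟨ih hf.1, by rw [map_smul]; exact ih hf.2⟩

/-- Each operator 1 - ∂_v uses up the first direction of the list and at most doubles the bound. -/
theorem SublistDerivsBdd.oneSubDeriv {l l' : List V} {M : ℝ} {f : CBSpace V F}
    (hf : SublistDerivsBdd (l ++ l') M f) :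
    SublistDerivsBdd l' (2 ^ l.length * M) (oneSubDeriv l f) := by
  induction l generalizing f M with
  | nil => simpa [oneSubDeriv_nil] using hf
  | cons v l ih =>
    have h := ih (hf.1.sub hf.2)
    rw [oneSubDeriv_cons]
    convert h using 1
    rw [List.length_cons]
    ring

/-- The operator `1 - ∂` commutes with linear maps that intertwine the derivatives. -/
theorem oneSubDeriv_map_comm {V' F' : Type*} [NormedAddCommGroup V'] [NormedSpace ℝ V']
    [NormedAddCommGroup F'] [NormedSpace ℝ F'] (S : CBSpace V F →ₗ[ℝ] CBSpace V' F')
    (e : V' → V) (hS : ∀ v f, CBSpace.deriv v (S f) = S (CBSpace.deriv (e v) f))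
    (l : List V') (f : CBSpace V F) : oneSubDeriv l (S f) = S (oneSubDeriv (l.map e) f) := by
  induction l generalizing f with
  | nil => rfl
  | cons v l ih => rw [List.map_cons, oneSubDeriv_cons, oneSubDeriv_cons, hS, ← map_sub, ih]

end OneSubDeriv

/-! ### Integration by parts against Schwartz functions -/

section IntegrationByParts

open scoped LineDeriv

variable {V F₁ F₂ F₃ : Type*} [NormedAddCommGroup V] [NormedSpace ℝ V] [FiniteDimensional ℝ V]
  [MeasurableSpace V] [BorelSpace V]
  [NormedAddCommGroup F₁] [NormedSpace ℝ F₁] [NormedAddCommGroup F₂] [NormedSpace ℝ F₂]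
  [NormedAddCommGroup F₃] [NormedSpace ℝ F₃] {μ : Measure V} [μ.IsAddHaarMeasure]

theorem CBSpace.integrable_bilin (B : F₁ →L[ℝ] F₂ →L[ℝ] F₃) (f : CBSpace V F₁) (g : 𝓢(V, F₂)) :
    Integrable (fun x => B ((f : V → F₁) x) (g x)) μ := by
  obtain ⟨C, hC0, hC⟩ := CBSpace.bounded f
  refine (g.integrable.norm.const_mul (‖B‖ * C)).mono'
    ((B.continuous.comp (CBSpace.continuous f)).clm_apply g.continuous).aestronglyMeasurable
    (Eventually.of_forall fun x => (B.le_opNorm₂ _ _).trans ?_)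
  have := hC x
  gcongr

theorem CBSpace.integral_bilin_deriv (B : F₁ →L[ℝ] F₂ →L[ℝ] F₃) (f : CBSpace V F₁) (g : 𝓢(V, F₂))
    (v : V) : ∫ x, B ((f : V → F₁) x) (∂_{v} g x) ∂μ =
      -∫ x, B ((CBSpace.deriv v f : V → F₁) x) (g x) ∂μ :=
  integral_bilinear_hasLineDerivAt_right_eq_neg_left_of_integrable
    (CBSpace.integrable_bilin B _ g) (CBSpace.integrable_bilin B f (∂_{v} g))
    (CBSpace.integrable_bilin B f g) (fun x _ => CBSpace.hasLineDerivAt v f x)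
    (fun x _ => by
      rw [SchwartzMap.lineDerivOp_apply]
      exact g.differentiableAt.lineDifferentiableAt.hasLineDerivAt)

/-- The composition of the operators `1 + ∂_v` on the Schwartz space, for `v` in a list. -/
noncomputable def oneAddDeriv : List V → 𝓢(V, F₂) → 𝓢(V, F₂)
  | [], g => g
  | v :: l, g => oneAddDeriv l g + ∂_{v} (oneAddDeriv l g)

/-- Transposition turns 1 + ∂_v into 1 - ∂_v and reverses the order of composition: the head of the
list acts last on g and first on f. No commutation of derivatives is required. -/
theorem CBSpace.integral_bilin_oneAddDeriv (B : F₁ →L[ℝ] F₂ →L[ℝ] F₃) (l : List V)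
    (f : CBSpace V F₁) (g : 𝓢(V, F₂)) :
    ∫ x, B ((f : V → F₁) x) (oneAddDeriv l g x) ∂μ =
      ∫ x, B ((oneSubDeriv l f : V → F₁) x) (g x) ∂μ := by
  induction l generalizing f with
  | nil => rfl
  | cons v l ih =>
    rw [oneSubDeriv_cons, ← ih, oneAddDeriv]
    have h1 : ∀ x, B ((f : V → F₁) x) ((oneAddDeriv l g + ∂_{v} (oneAddDeriv l g)) x) =
        B ((f : V → F₁) x) (oneAddDeriv l g x) + B ((f : V → F₁) x) (∂_{v} (oneAddDeriv l g) x) :=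
      fun x => by rw [add_apply, map_add]
    have h2 : ∀ x, B (((f - CBSpace.deriv v f : CBSpace V F₁) : V → F₁) x) (oneAddDeriv l g x) =
        B ((f : V → F₁) x) (oneAddDeriv l g x) -
          B ((CBSpace.deriv v f : V → F₁) x) (oneAddDeriv l g x) := fun x => by
      rw [Submodule.coe_sub, Pi.sub_apply, map_sub, sub_apply]
    simp only [h1, h2]
    rw [integral_add (CBSpace.integrable_bilin B f _) (CBSpace.integrable_bilin B f _),
      integral_sub (CBSpace.integrable_bilin B f _) (CBSpace.integrable_bilin B _ _),
      CBSpace.integral_bilin_deriv, sub_eq_add_neg]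

end IntegrationByParts

/-! ### Trading a plane wave for a window -/

section PhaseShift

open scoped FourierTransform LineDeriv

variable {n : ℕ} {G : Type*} [NormedAddCommGroup G] [NormedSpace ℂ G]

variable (n) in
/-- The standard basis, as a list in decreasing order. -/
noncomputable def stdVecList : List (RSpace n) := ((List.finRange n).map stdVec).reverse

theorem exists_oneAddDeriv_fourier (l : List (Fin n)) (p : 𝓢(RSpace n, G)) :
    ∃ q : 𝓢(RSpace n, G), oneAddDeriv (l.map stdVec) (𝓕 p) = 𝓕 q ∧
      ∀ t, q t = (l.map fun i => (1 - 2 * Real.pi * Complex.I * t i : ℂ)).prod • p t := by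
  induction l with
  | nil => exact ⟨p, rfl, by simp⟩
  | cons i l ih =>
    obtain ⟨q, hq, hqt⟩ := ih
    refine ⟨q + (-(2 * Real.pi * Complex.I)) •
      SchwartzMap.smulLeftCLM G (fun t => inner ℝ t (stdVec i)) q, ?_, fun t => ?_⟩
    · rw [List.map_cons, oneAddDeriv, hq, SchwartzMap.lineDerivOp_fourier_eq,
        FourierTransform.fourier_add]
    · rw [List.map_cons, List.prod_cons, mul_smul, ← hqt, add_apply, smul_apply,
        SchwartzMap.smulLeftCLM_apply_apply (by fun_prop), sub_smul, one_smul, sub_eq_add_neg,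
        mul_smul _ (t i : ℂ), Complex.coe_smul, neg_smul]
      simp [stdVec, EuclideanSpace.inner_single_right]

theorem prod_mul_prodWindow (t : RSpace n) :
    ((List.finRange n).reverse.map fun i => (1 - 2 * Real.pi * Complex.I * t i : ℂ)).prod *
      prodWindow t = 1 := by
  rw [List.map_reverse, List.prod_reverse, ← Fin.prod_univ_def, prodWindow,
    ← Finset.prod_mul_distrib]
  exact Finset.prod_eq_one fun i _ => mul_inv_cancel₀ (one_sub_mul_I_ne_zero _)

variable {A : Type*} [NonUnitalCStarAlgebra A]

theorem fourier_compSubConst (w : 𝓢(RSpace n, A)) (x η : RSpace n) :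
    𝓕 (SchwartzMap.compSubConstCLM ℂ (-x) w) η = planeWave x η • 𝓕 w η := by
  simp only [SchwartzMap.fourier_coe, fourier_eq_integral_planeWave]
  rw [← integral_smul, ← integral_sub_right_eq_self (fun y => planeWave x η • planeWave (-y) η • w y)
    (-x)]
  refine integral_congr_ae (Eventually.of_forall fun y => ?_)
  simp only [SchwartzMap.compSubConstCLM_apply, smul_smul]
  rw [← planeWave_add_left]
  congr 2
  abel

theorem fourier_mul_compSubConst {h : RSpace n → ℂ} (hh : IsWindow h) (w : 𝓢(RSpace n, A))
    (x η : RSpace n) :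
    𝓕 (SchwartzMap.bilinRight (ContinuousLinearMap.lsmul ℝ ℂ) hh.isCBInfty.hasTemperateGrowth
      (SchwartzMap.compSubConstCLM ℂ (-x) w)) η = planeWave x η • stft h w x η := by
  rw [SchwartzMap.fourier_coe, fourier_eq_integral_planeWave, stft]
  rw [← integral_smul, ← integral_sub_right_eq_self
    (fun y => planeWave x η • planeWave (-y) η • h (y - x) • w y) (-x)]
  refine integral_congr_ae (Eventually.of_forall fun y => ?_)
  simp only [SchwartzMap.bilinRight_apply, ContinuousLinearMap.lsmul_apply,
    SchwartzMap.compSubConstCLM_apply, smul_smul]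
  rw [← mul_assoc (planeWave x η), ← planeWave_add_left, sub_neg_eq_add, add_sub_cancel_right]
  congr 3
  abel

/-- On the Fourier side ∏ⱼ (1 + ∂ⱼ) is multiplication by ∏ⱼ (1 - 2πi tⱼ), which the window is chosen
to cancel. -/
theorem oneAddDeriv_fourier_mul_prodWindow (w : 𝓢(RSpace n, A)) :
    oneAddDeriv (stdVecList n) (𝓕 (SchwartzMap.bilinRight (ContinuousLinearMap.lsmul ℝ ℂ)
      isWindow_prodWindow.isCBInfty.hasTemperateGrowth w)) = 𝓕 w := by
  obtain ⟨q, hq, hqt⟩ := exists_oneAddDeriv_fourier (List.finRange n).reverse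
    (SchwartzMap.bilinRight (ContinuousLinearMap.lsmul ℝ ℂ)
      isWindow_prodWindow.isCBInfty.hasTemperateGrowth w)
  rw [stdVecList, ← List.map_reverse, hq]
  congr 1
  ext t
  rw [hqt, SchwartzMap.bilinRight_apply, ContinuousLinearMap.lsmul_apply, smul_smul,
    prod_mul_prodWindow, one_smul]

/-- The phase is absorbed as a translation: e^{2πi x·η} ŵ(η) is the transform of w(· + x), and
windowing this translate produces the short-time transform centred at x. Integration by parts
therefore differentiates f only, never the phase, so no powers of x appear. -/
theorem integral_bilin_planeWave_fourier {F₁ F₃ : Type*} [NormedAddCommGroup F₁]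
    [NormedSpace ℝ F₁] [NormedAddCommGroup F₃] [NormedSpace ℝ F₃] (B : F₁ →L[ℝ] A →L[ℝ] F₃)
    (f : CBSpace (RSpace n) F₁) (w : 𝓢(RSpace n, A)) (x : RSpace n) :
    ∫ η, B ((f : RSpace n → F₁) η) (planeWave x η • 𝓕 w η) =
      ∫ η, B ((oneSubDeriv (stdVecList n) f : RSpace n → F₁) η)
        (planeWave x η • stft prodWindow w x η) := by
  have h := CBSpace.integral_bilin_oneAddDeriv (μ := volume) B (stdVecList n) f
    (𝓕 (SchwartzMap.bilinRight (ContinuousLinearMap.lsmul ℝ ℂ)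
      isWindow_prodWindow.isCBInfty.hasTemperateGrowth (SchwartzMap.compSubConstCLM ℂ (-x) w)))
  rw [oneAddDeriv_fourier_mul_prodWindow] at h
  simpa only [fourier_compSubConst, fourier_mul_compSubConst isWindow_prodWindow] using h

end PhaseShift

/-! ### The estimate on phase space -/

section PhaseSpaceEstimate

open scoped FourierTransform

variable {n : ℕ} {A : Type*} [NonUnitalCStarAlgebra A] {h : RSpace n → ℂ}

variable (A) in
/-- The sesquilinear form `(a, b) ↦ a* b`. -/
noncomputable def starMulSesq : A →L⋆[ℂ] A →L[ℂ] A :=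
  (ContinuousLinearMap.mul ℂ A).comp ((starL ℂ : A ≃L⋆[ℂ] A) : A →L⋆[ℂ] A)

variable (A) in
/-- The sesquilinear form `(a, b) ↦ b a*`. -/
noncomputable def mulStarSesq : A →L⋆[ℂ] A →L[ℂ] A :=
  (ContinuousLinearMap.mul ℂ A).flip.comp ((starL ℂ : A ≃L⋆[ℂ] A) : A →L⋆[ℂ] A)

theorem starMulSesq_apply (a b : A) : starMulSesq A a b = star a * b := rfl

theorem mulStarSesq_apply (a b : A) : mulStarSesq A a b = b * star a := rfl

/-- The function `(x, η) ↦ e^{2π i η·x} V(η, x)`, where `V` is the short-time Fourier transform of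
`w` with respect to the product window. -/
noncomputable def dualStft (w : 𝓢(RSpace n, A)) (z : RSpace n × RSpace n) : A :=
  planeWave z.2 z.1 • stft prodWindow w z.2 z.1

theorem dualStft_mul_star (w : 𝓢(RSpace n, A)) (z : RSpace n × RSpace n) :
    dualStft w z * star (dualStft w z) =
      mulStarSesq A (stft prodWindow w z.2 z.1) (stft prodWindow w z.2 z.1) := by
  rw [dualStft, star_smul, smul_mul_smul_comm, ← planeWave_neg_left, planeWave_mul_neg, one_smul,
    mulStarSesq_apply]

theorem continuous_dualStft (w : 𝓢(RSpace n, A)) : Continuous (dualStft w) := by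
  have h1 : Continuous fun z : RSpace n × RSpace n => planeWave z.2 z.1 := by fun_prop
  have h2 : Continuous ((fun z : RSpace n × RSpace n => stft prodWindow w z.1 z.2) ∘ Prod.swap) :=
    (isWindow_prodWindow.continuous_stft w).comp continuous_swap
  have h3 : dualStft w = fun z => planeWave z.2 z.1 •
      ((fun z : RSpace n × RSpace n => stft prodWindow w z.1 z.2) ∘ Prod.swap) z := rfl
  rw [h3]
  exact h1.smul h2

theorem integrable_dualStft_mul_star (w : 𝓢(RSpace n, A)) :
    Integrable fun z => dualStft w z * star (dualStft w z) := by
  simp only [dualStft_mul_star]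
  exact (isWindow_prodWindow.integrable_sesq_stft w (mulStarSesq A)).swap

theorem integral_dualStft_mul_star (w : 𝓢(RSpace n, A)) :
    ∫ z, dualStft w z * star (dualStft w z) =
      (∫ t : RSpace n, ‖prodWindow t‖ ^ 2) • ∫ y, w y * star (w y) := by
  simp only [dualStft_mul_star]
  simp only [← mulStarSesq_apply]
  rw [← (isWindow_prodWindow (n := n)).integral_sesq_stft w (mulStarSesq A)]
  exact integral_prod_swap (μ := (volume : Measure (RSpace n))) (ν := (volume : Measure (RSpace n)))
    (fun z : RSpace n × RSpace n =>
    mulStarSesq A (stft prodWindow w z.1 z.2) (stft prodWindow w z.1 z.2))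

theorem exists_dualStft_bound (w : 𝓢(RSpace n, A)) :
    ∃ C, 0 ≤ C ∧ ∀ x η, ‖dualStft w (x, η)‖ ≤ C * ((1 + ‖x‖) ^ (n + 1))⁻¹ := by
  obtain ⟨C, hC0, hC⟩ := isWindow_prodWindow.exists_stft_bound w
  refine ⟨C, hC0, fun x η => ?_⟩
  rw [dualStft, norm_smul, norm_planeWave, one_mul]
  refine (hC η x).trans (mul_le_mul_of_nonneg_left ?_ hC0)
  exact mul_le_of_le_one_left (by positivity) (inv_le_one_of_one_le₀ (one_le_windowWeight η))

theorem IsWindow.exists_stft_bound_right (hh : IsWindow h) (u : 𝓢(RSpace n, A)) :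
    ∃ C, 0 ≤ C ∧ ∀ x η, ‖stft h u x η‖ ≤ C * ((1 + ‖η‖) ^ (n + 1))⁻¹ := by
  obtain ⟨C, hC0, hC⟩ := hh.exists_stft_bound u
  refine ⟨C, hC0, fun x η => (hC x η).trans (mul_le_mul_of_nonneg_left ?_ hC0)⟩
  exact mul_le_of_le_one_left (by positivity) (inv_le_one_of_one_le₀ (one_le_windowWeight x))

/-- The function `x ↦ b(x, η) U(x, η)`, where `U` is the short-time Fourier transform of `u`. -/
noncomputable def stftMul (b : CBSpace (RSpace n × RSpace n) A) (hh : IsWindow h)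
    (u : 𝓢(RSpace n, A)) (η : RSpace n) : CBSpace (RSpace n) A :=
  ⟨fun x => (b : RSpace n × RSpace n → A) (x, η) * stft h u x η,
    ((CBSpace.isCBInfty b).slice_left η).bilinear (ContinuousLinearMap.mul ℝ A)
      (hh.isCBInfty_stft u η)⟩

theorem deriv_stftMul (b : CBSpace (RSpace n × RSpace n) A) (hh : IsWindow h)
    (u : 𝓢(RSpace n, A)) (η : RSpace n) (j : Fin n) :
    CBSpace.deriv (stdVec j) (stftMul b hh u η) =
      stftMul (CBSpace.deriv (stdVec j, 0) b) hh u η -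
        stftMul b (hh.lineDeriv (stdVec j)) u η := by
  refine Subtype.ext (funext fun x => ?_)
  have h1 := ((CBSpace.isCBInfty b).slice_left η).differentiable x
  have h2 := (hh.isCBInfty_stft u η).differentiable x
  have h3 := (ContinuousLinearMap.mul ℝ A).hasFDerivAt_of_bilinear h1.hasFDerivAt h2.hasFDerivAt
  have h4 := (h3.hasLineDerivAt (stdVec j)).lineDeriv
  have h5 := (hh.hasLineDerivAt_stft u η x j).lineDeriv
  rw [h2.lineDeriv_eq_fderiv] at h5
  have h6 := lineDeriv_slice_left (b : RSpace n × RSpace n → A) x η (stdVec j)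
  rw [h1.lineDeriv_eq_fderiv] at h6
  refine h4.trans ?_
  simp [h5, h6, stftMul, CBSpace.deriv_apply]
  abel

/-- The window derivative appears with a plus sign, since h(y - x) changes sign under
differentiation in x and so does ∂ in 1 - ∂. -/
theorem stftMul_sub_deriv (b : CBSpace (RSpace n × RSpace n) A) (hh : IsWindow h)
    (u : 𝓢(RSpace n, A)) (η : RSpace n) (j : Fin n) :
    stftMul b hh u η - CBSpace.deriv (stdVec j) (stftMul b hh u η) =
      stftMul (b - CBSpace.deriv (stdVec j, 0) b) hh u η +
        stftMul b (hh.lineDeriv (stdVec j)) u η := by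
  rw [deriv_stftMul, sub_sub_eq_add_sub, add_sub_right_comm]
  congr 1
  refine Subtype.ext (funext fun x => ?_)
  simp [stftMul, sub_mul]

/-- The product of `dualStft` and the iterated derivative of `stftMul`. -/
noncomputable def phaseIntegrand (w : 𝓢(RSpace n, A)) (l : List (Fin n))
    (b : CBSpace (RSpace n × RSpace n) A) (hh : IsWindow h) (u : 𝓢(RSpace n, A))
    (z : RSpace n × RSpace n) : A :=
  dualStft w z * (oneSubDeriv (l.map stdVec) (stftMul b hh u z.2) : RSpace n → A) z.1

theorem phaseIntegrand_nil_estimate (hh : IsWindow h) {b : CBSpace (RSpace n × RSpace n) A} {M : ℝ}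
    (hb : ∀ z, ‖(b : RSpace n × RSpace n → A) z‖ ≤ M) (u w : 𝓢(RSpace n, A)) :
    Integrable (phaseIntegrand w [] b hh u) ∧ ‖∫ z, phaseIntegrand w [] b hh u z‖ ≤
      √(∫ t : RSpace n, ‖prodWindow t‖ ^ 2) * √(∫ t, ‖h t‖ ^ 2) * M *
        √‖∫ y, w y * star (w y)‖ * √‖∫ y, star (u y) * u y‖ := by
  have hM0 : 0 ≤ M := (norm_nonneg _).trans (hb 0)
  have hbc := CBSpace.continuous b
  have hYc := hh.continuous_stft u
  have hHc := continuous_dualStft w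
  obtain ⟨C, hC0, hC⟩ := exists_dualStft_bound w
  obtain ⟨D, hD0, hD⟩ := hh.exists_stft_bound_right u
  have hYi : Integrable fun z : RSpace n × RSpace n =>
      star (stft h u z.1 z.2) * stft h u z.1 z.2 := hh.integrable_sesq_stft u (starMulSesq A)
  have hbYi : Integrable fun z : RSpace n × RSpace n =>
      star ((b : RSpace n × RSpace n → A) z * stft h u z.1 z.2) *
        ((b : RSpace n × RSpace n → A) z * stft h u z.1 z.2) := by
    refine (hYi.norm.const_mul (M ^ 2)).mono' (Continuous.aestronglyMeasurable (by fun_prop))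
      (Eventually.of_forall fun z => ?_)
    rw [CStarRing.norm_star_mul_self, CStarRing.norm_star_mul_self, ← sq, ← sq, ← mul_pow]
    exact pow_le_pow_left₀ (norm_nonneg _) ((norm_mul_le _ _).trans
      (mul_le_mul_of_nonneg_right (hb z) (norm_nonneg _))) 2
  -- Absolute integrability uses decay in x from the transform of w and decay in η from that of u.
  have hint : Integrable (phaseIntegrand w [] b hh u) := by
    refine integrable_prod_of_norm_le (hHc.mul (hbc.mul hYc)) integrable_one_add_norm_pow_inv
      integrable_one_add_norm_pow_inv (C * (M * D)) fun x η => ?_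
    refine (norm_mul_le _ _).trans ?_
    calc _ ≤ (C * ((1 + ‖x‖) ^ (n + 1))⁻¹) * (M * (D * ((1 + ‖η‖) ^ (n + 1))⁻¹)) := by
          refine mul_le_mul (hC x η) ?_ (norm_nonneg _) (by positivity)
          refine (norm_mul_le _ _).trans ?_
          exact mul_le_mul (hb _) (hD x η) (norm_nonneg _) hM0
      _ = _ := by ring
  refine ⟨hint, ?_⟩
  have key := norm_integral_mul_mul_le (μ := (volume : Measure (RSpace n × RSpace n)))
    (H := dualStft w) (b := (b : RSpace n × RSpace n → A))
    (Y := fun z => stft h u z.1 z.2) hM0 hb (integrable_dualStft_mul_star w) hbYi hYi hint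
  refine key.trans (le_of_eq ?_)
  rw [integral_dualStft_mul_star]
  have hY := hh.integral_sesq_stft u (starMulSesq A)
  simp only [starMulSesq_apply] at hY
  rw [hY, norm_smul, norm_smul, Real.norm_of_nonneg (integral_nonneg fun t => by positivity),
    Real.norm_of_nonneg (integral_nonneg fun t => by positivity),
    Real.sqrt_mul (integral_nonneg fun t => by positivity),
    Real.sqrt_mul (integral_nonneg fun t => by positivity)]
  ring

/-- Induction over the operators 1 - ∂ⱼ: each splits the integral into one with symbol (1 - ∂ⱼ)b and
one with window ∂ⱼh. The window must vary in the induction, and `K` depends on it but not on b, u or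
w. -/
theorem exists_phaseIntegrand_estimate (l : List (Fin n)) (hh : IsWindow h) :
    ∃ K, 0 ≤ K ∧ ∀ (b : CBSpace (RSpace n × RSpace n) A) (M : ℝ) (u w : 𝓢(RSpace n, A)),
      SublistDerivsBdd (l.map fun i => ((stdVec i, 0) : RSpace n × RSpace n)) M b →
      Integrable (phaseIntegrand w l b hh u) ∧ ‖∫ z, phaseIntegrand w l b hh u z‖ ≤
        K * M * √‖∫ y, w y * star (w y)‖ * √‖∫ y, star (u y) * u y‖ := by
  induction l generalizing h with
  | nil => exact ⟨_, by positivity, fun b M u w hb => phaseIntegrand_nil_estimate hh hb u w⟩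
  | cons i l ih =>
    obtain ⟨K₁, hK₁, h₁⟩ := ih hh
    obtain ⟨K₂, hK₂, h₂⟩ := ih (hh.lineDeriv (stdVec i))
    -- The factor 2 is the cost of b - ∂ⱼb; the second term keeps b, with its bound M, and changes
    -- the window.
    refine ⟨K₁ * 2 + K₂, by positivity, fun b M u w hb => ?_⟩
    obtain ⟨hi₁, hn₁⟩ := h₁ _ _ u w (hb.1.sub hb.2)
    obtain ⟨hi₂, hn₂⟩ := h₂ _ _ u w hb.1
    have he : phaseIntegrand w (i :: l) b hh u = fun z =>
        phaseIntegrand w l (b - CBSpace.deriv (stdVec i, 0) b) hh u z +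
          phaseIntegrand w l b (hh.lineDeriv (stdVec i)) u z := funext fun z => by
      rw [phaseIntegrand, List.map_cons, oneSubDeriv_cons, stftMul_sub_deriv, map_add,
        Submodule.coe_add, Pi.add_apply, mul_add]
      rfl
    rw [he]
    refine ⟨hi₁.add hi₂, ?_⟩
    rw [integral_add hi₁ hi₂]
    refine (norm_add_le _ _).trans ((add_le_add hn₁ hn₂).trans_eq (by ring))

end PhaseSpaceEstimate

/-! ### The pairing ⟨v, Tu⟩ as a phase-space integral -/

section Pairing

open scoped FourierTransform

variable {n : ℕ} {A : Type*} [NonUnitalCStarAlgebra A]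

/-- The restriction `f ↦ f(x, ·)` as a linear map. -/
def CBSpace.sliceRight {V V' F : Type*} [NormedAddCommGroup V] [NormedSpace ℝ V]
    [NormedAddCommGroup V'] [NormedSpace ℝ V'] [NormedAddCommGroup F] [NormedSpace ℝ F] (x : V) :
    CBSpace (V × V') F →ₗ[ℝ] CBSpace V' F where
  toFun f := ⟨fun y => (f : V × V' → F) (x, y), (CBSpace.isCBInfty f).slice_right x⟩
  map_add' _ _ := rfl
  map_smul' _ _ := rfl

theorem CBSpace.deriv_sliceRight (x v : RSpace n) (f : CBSpace (RSpace n × RSpace n) A) :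
    CBSpace.deriv v (CBSpace.sliceRight x f) = CBSpace.sliceRight x (CBSpace.deriv (0, v) f) := by
  refine Subtype.ext (funext fun y => ?_)
  simp [CBSpace.deriv_apply, CBSpace.sliceRight, lineDeriv]

/-- The pointwise adjoint of a Schwartz function. -/
noncomputable def schwartzStar (v : 𝓢(RSpace n, A)) : 𝓢(RSpace n, A) :=
  SchwartzMap.postcompCLM ((starL' ℝ : A ≃L[ℝ] A) : A →L[ℝ] A) v

theorem schwartzStar_apply (v : 𝓢(RSpace n, A)) (x : RSpace n) : schwartzStar v x = star (v x) :=
  rfl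

/-- The integrated symbol `∏ⱼ (1 - ∂_{ηⱼ}) a`. -/
noncomputable def oneSubFiberDeriv (a : CBSpace (RSpace n × RSpace n) A) :
    CBSpace (RSpace n × RSpace n) A :=
  oneSubDeriv ((stdVecList n).map fun v => (0, v)) a

theorem pdoFun_eq_integral_stft (a : CBSpace (RSpace n × RSpace n) A) (u : 𝓢(RSpace n, A))
    (x : RSpace n) : pdoFun a u x = ∫ η, planeWave x η •
      ((oneSubFiberDeriv a : RSpace n × RSpace n → A) (x, η) * stft prodWindow u x η) := by
  have h := integral_bilin_planeWave_fourier (ContinuousLinearMap.mul ℝ A)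
    (CBSpace.sliceRight x a) u x
  rw [oneSubDeriv_map_comm (CBSpace.sliceRight x) (fun v => (0, v))
    (fun v f => CBSpace.deriv_sliceRight x v f)] at h
  simp only [ContinuousLinearMap.mul_apply', mul_smul_comm] at h
  exact h

theorem integrable_pairing (v u : 𝓢(RSpace n, A)) (b : CBSpace (RSpace n × RSpace n) A) :
    Integrable fun z : RSpace n × RSpace n => star (v z.1) *
      planeWave z.1 z.2 • ((b : RSpace n × RSpace n → A) z * stft prodWindow u z.1 z.2) := by
  have hbc := CBSpace.continuous b
  have hYc := (isWindow_prodWindow (n := n)).continuous_stft u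
  obtain ⟨C, hC0, hC⟩ := CBSpace.bounded b
  obtain ⟨D, hD0, hD⟩ := (isWindow_prodWindow (n := n)).exists_stft_bound_right u
  refine integrable_prod_of_norm_le (by fun_prop) v.integrable.norm
    integrable_one_add_norm_pow_inv (C * D) fun x η => ?_
  refine (norm_mul_le _ _).trans ?_
  rw [norm_star, norm_smul, norm_planeWave, one_mul]
  calc _ ≤ ‖v x‖ * (C * (D * ((1 + ‖η‖) ^ (n + 1))⁻¹)) := by
        refine mul_le_mul_of_nonneg_left ((norm_mul_le _ _).trans ?_) (norm_nonneg _)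
        exact mul_le_mul (hC _) (hD x η) (norm_nonneg _) hC0
    _ = _ := by ring

theorem IsWindow.continuous_stft_right {h : RSpace n → ℂ} (hh : IsWindow h) (u : 𝓢(RSpace n, A))
    (x : RSpace n) : Continuous (stft h u x) := by
  rw [funext (stft_eq_fourier hh u x)]
  exact SchwartzMap.continuous _

theorem star_mul_pdoFun_eq_integral (a : CBSpace (RSpace n × RSpace n) A) (v u : 𝓢(RSpace n, A))
    (x : RSpace n) : star (v x) * pdoFun a u x = ∫ η, star (v x) * planeWave x η •
      ((oneSubFiberDeriv a : RSpace n × RSpace n → A) (x, η) * stft prodWindow u x η) := by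
  have hbc := CBSpace.continuous (oneSubFiberDeriv a)
  obtain ⟨C, hC0, hC⟩ := CBSpace.bounded (oneSubFiberDeriv a)
  obtain ⟨D, hD0, hD⟩ := (isWindow_prodWindow (n := n)).exists_stft_bound_right u
  have hYx := (isWindow_prodWindow (n := n)).continuous_stft_right u x
  have hi : Integrable fun η => planeWave x η •
      ((oneSubFiberDeriv a : RSpace n × RSpace n → A) (x, η) * stft prodWindow u x η) := by
    refine (integrable_one_add_norm_pow_inv.const_mul (C * D)).mono'
      (Continuous.aestronglyMeasurable (by fun_prop)) (Eventually.of_forall fun η => ?_)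
    rw [norm_smul, norm_planeWave, one_mul, mul_assoc]
    exact (norm_mul_le _ _).trans (mul_le_mul (hC _) (hD x η) (norm_nonneg _) hC0)
  rw [pdoFun_eq_integral_stft]
  exact ((ContinuousLinearMap.mul ℝ A (star (v x))).integral_comp_comm hi).symm

/-- The second use of the phase-shift identity, now in x at fixed η: v* is the Fourier transform of
w = 𝓕⁻(v*), and the remaining factor bU is bounded and smooth. The bilinear map is flipped so that
v* stays on the left. -/
theorem integral_star_mul_planeWave_eq (b : CBSpace (RSpace n × RSpace n) A)
    (v u : 𝓢(RSpace n, A)) (η : RSpace n) :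
    ∫ x, star (v x) * planeWave x η •
      ((b : RSpace n × RSpace n → A) (x, η) * stft prodWindow u x η) =
      ∫ x, phaseIntegrand (𝓕⁻ (schwartzStar v)) (List.finRange n).reverse b
        isWindow_prodWindow u (x, η) := by
  have h := integral_bilin_planeWave_fourier (ContinuousLinearMap.mul ℝ A).flip
    (stftMul b isWindow_prodWindow u η) (𝓕⁻ (schwartzStar v)) η
  rw [FourierTransform.fourier_fourierInv_eq, stdVecList, ← List.map_reverse] at h
  have h1 : ∀ x, (ContinuousLinearMap.mul ℝ A).flip
      ((stftMul b isWindow_prodWindow u η : RSpace n → A) x)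
      (planeWave η x • schwartzStar v x) = star (v x) * planeWave x η •
      ((b : RSpace n × RSpace n → A) (x, η) * stft prodWindow u x η) := fun x => by
    rw [ContinuousLinearMap.flip_apply, ContinuousLinearMap.mul_apply', schwartzStar_apply,
      smul_mul_assoc, mul_smul_comm, planeWave_comm x η]
    rfl
  simp only [h1] at h
  exact h

/-- Fubini is used twice: before the integration by parts in x, where v supplies the decay in x, and
after it, where integrability is the hypothesis `hint`. -/
theorem integral_star_mul_pdoFun (a : CBSpace (RSpace n × RSpace n) A) (v u : 𝓢(RSpace n, A))
    (hint : Integrable (phaseIntegrand (𝓕⁻ (schwartzStar v)) (List.finRange n).reverse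
      (oneSubFiberDeriv a) isWindow_prodWindow u)) :
    ∫ x, star (v x) * pdoFun a u x = ∫ z, phaseIntegrand (𝓕⁻ (schwartzStar v))
      (List.finRange n).reverse (oneSubFiberDeriv a) isWindow_prodWindow u z := by
  simp only [star_mul_pdoFun_eq_integral]
  rw [integral_integral_swap (integrable_pairing v u (oneSubFiberDeriv a))]
  simp only [integral_star_mul_planeWave_eq]
  rw [Measure.volume_eq_prod] at hint ⊢
  rw [integral_prod_symm _ hint]

/-- Plancherel for the form (a, b) ↦ ba*. The reversed product produced by Cauchy–Schwarz is undone
by the adjoint in v*, which returns ⟨v, v⟩. -/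
theorem integral_fourierInv_star_mul_star (v : 𝓢(RSpace n, A)) :
    ∫ y, 𝓕⁻ (schwartzStar v) y * star (𝓕⁻ (schwartzStar v) y) = schwartzInner v v := by
  have h := SchwartzMap.integral_sesq_fourier_fourier (𝓕⁻ (schwartzStar v))
    (𝓕⁻ (schwartzStar v)) (mulStarSesq A)
  rw [FourierTransform.fourier_fourierInv_eq] at h
  simp only [mulStarSesq_apply, schwartzStar_apply, star_star] at h
  exact h.symm

end Pairing

/-! ### Control of symbol derivatives by π(a) -/

section SymbolNorm

variable {n : ℕ} {V F : Type*} [NormedAddCommGroup V] [NormedSpace ℝ V]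
  [NormedAddCommGroup F] [NormedSpace ℝ F]

/-- Iterated partial derivatives along a list of directions, on the space of `CB^∞` functions. -/
noncomputable def CBSpace.listDeriv (e : Fin n → V) (β : Fin n → ℕ) (l : List (Fin n))
    (f : CBSpace V F) : CBSpace V F :=
  l.foldr (fun i g => (CBSpace.deriv (e i))^[β i] g) f

theorem CBSpace.coe_listDeriv (e : Fin n → V) (β : Fin n → ℕ) (f : CBSpace V F) :
    (CBSpace.listDeriv e β (List.finRange n) f : V → F) = multiDeriv e β (f : V → F) := by
  rw [CBSpace.listDeriv, multiDeriv]
  have hit : ∀ (v : V) (k : ℕ) (g : CBSpace V F), (((CBSpace.deriv v)^[k] g : CBSpace V F) : V → F) =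
      (fun h z => lineDeriv ℝ h z v)^[k] (g : V → F) := by
    intro v k
    induction k with
    | zero => exact fun g => rfl
    | succ k ih =>
      intro g
      rw [Function.iterate_succ_apply, Function.iterate_succ_apply, ih]
      rfl
  induction List.finRange n with
  | nil => rfl
  | cons i l ih => rw [List.foldr_cons, List.foldr_cons, hit, ih]

theorem CBSpace.listDeriv_congr (e : Fin n → V) {β β' : Fin n → ℕ} {l : List (Fin n)}
    (h : ∀ i ∈ l, β i = β' i) (f : CBSpace V F) :
    CBSpace.listDeriv e β l f = CBSpace.listDeriv e β' l f := by
  induction l with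
  | nil => rfl
  | cons i l ih =>
    have h1 := ih fun j hj => h j (List.mem_cons_of_mem _ hj)
    rw [CBSpace.listDeriv] at h1 ⊢
    rw [CBSpace.listDeriv] at h1 ⊢
    rw [List.foldr_cons, List.foldr_cons, h1, h i List.mem_cons_self]

/-- The right fold in `listDeriv` lets the last index act first, whereas `SublistDerivsBdd`
differentiates along the head first; hence the reversal. Exponents 0 and 1 encode whether a
direction is skipped or used. -/
theorem sublistDerivsBdd_of_listDeriv (e : Fin n → V) {l : List (Fin n)} (hl : l.Nodup)
    {l' : List V} {M : ℝ} {f : CBSpace V F}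
    (h : ∀ β : Fin n → ℕ, β ≤ 1 → SublistDerivsBdd l' M (CBSpace.listDeriv e β l f)) :
    SublistDerivsBdd (l.reverse.map e ++ l') M f := by
  induction l using List.reverseRecOn generalizing f with
  | nil => exact h 0 (zero_le_one)
  | append_singleton l i ih =>
    rw [List.nodup_append] at hl
    have hi : ∀ j ∈ l, j ≠ i := fun j hj => hl.2.2 j hj i (by simp)
    rw [List.reverse_append, List.reverse_singleton, List.singleton_append, List.map_cons,
      List.cons_append]
    have key : ∀ k ≤ 1, ∀ β : Fin n → ℕ, β ≤ 1 → SublistDerivsBdd l' M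
        (CBSpace.listDeriv e β l ((CBSpace.deriv (e i))^[k] f)) := fun k hk β hβ => by
      have h1 := h (Function.update β i k) fun j => by
        by_cases hj : j = i
        · subst hj; simpa using hk
        · simpa [hj] using hβ j
      rw [CBSpace.listDeriv, List.foldr_append, List.foldr_cons, List.foldr_nil,
        Function.update_self] at h1
      have h2 := CBSpace.listDeriv_congr e (β := Function.update β i k) (β' := β) (l := l)
        (fun j hj => by rw [Function.update_of_ne (hi j hj)]) ((CBSpace.deriv (e i))^[k] f)
      rw [← h2]
      exact h1
    exact ⟨ih hl.1 (key 0 zero_le_one), ih hl.1 (key 1 le_rfl)⟩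

variable {A : Type*} [NonUnitalCStarAlgebra A]

theorem norm_mixedDeriv_le_symbolNorm {a : RSpace n × RSpace n → A} (ha : IsCBInfty a)
    {β γ : Fin n → ℕ} (hβ : β ≤ 1) (hγ : γ ≤ 1) (z : RSpace n × RSpace n) :
    ‖mixedDeriv β γ a z‖ ≤ symbolNorm a := by
  refine le_csSup ?_ ⟨β, γ, z, hβ, hγ, rfl⟩
  have hbdd : ∀ β γ : Fin n → ℕ, ∃ C, ∀ z, ‖mixedDeriv β γ a z‖ ≤ C := fun β γ => by
    let f : CBSpace (RSpace n × RSpace n) A := CBSpace.listDeriv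
      (fun i => ((stdVec i, 0) : RSpace n × RSpace n)) β (List.finRange n)
      (CBSpace.listDeriv (fun i => ((0, stdVec i) : RSpace n × RSpace n)) γ
        (List.finRange n) (⟨a, ha⟩ : CBSpace (RSpace n × RSpace n) A))
    have hf : (f : RSpace n × RSpace n → A) = mixedDeriv β γ a := by
      rw [CBSpace.coe_listDeriv, CBSpace.coe_listDeriv]
      rfl
    obtain ⟨C, -, hC⟩ := CBSpace.bounded f
    exact ⟨C, fun z => hf ▸ hC z⟩
  choose C hC using hbdd
  -- Only finitely many pairs of multi-indices occur, so the sum of their bounds dominates all of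
  -- them and the supremum is a genuine one.
  refine ⟨∑ p ∈ (Finset.Icc 0 1 : Finset (Fin n → ℕ)) ×ˢ (Finset.Icc 0 1 : Finset (Fin n → ℕ)), |C p.1 p.2|, ?_⟩
  rintro _ ⟨β, γ, z, hβ, hγ, rfl⟩
  refine ((hC β γ z).trans (le_abs_self _)).trans ?_
  exact Finset.single_le_sum (f := fun p : (Fin n → ℕ) × (Fin n → ℕ) => |C p.1 p.2|)
    (fun _ _ => abs_nonneg _) (Finset.mk_mem_product
      (Finset.mem_Icc.2 ⟨zero_le, hβ⟩) (Finset.mem_Icc.2 ⟨zero_le, hγ⟩))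

theorem symbolNorm_nonneg (a : RSpace n × RSpace n → A) : 0 ≤ symbolNorm a := by
  refine Real.sSup_nonneg ?_
  rintro _ ⟨β, γ, z, -, -, rfl⟩
  exact norm_nonneg _

theorem sublistDerivsBdd_symbolNorm (a : CBSpace (RSpace n × RSpace n) A) :
    SublistDerivsBdd ((stdVecList n).map (fun v => ((0, v) : RSpace n × RSpace n)) ++
      (List.finRange n).reverse.map fun i => ((stdVec i, 0) : RSpace n × RSpace n))
      (symbolNorm (a : RSpace n × RSpace n → A)) a := by
  rw [stdVecList, ← List.map_reverse, List.map_map]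
  refine sublistDerivsBdd_of_listDeriv (fun i => ((0, stdVec i) : RSpace n × RSpace n))
    (List.nodup_finRange n) fun γ hγ => ?_
  rw [← List.append_nil (List.map _ _)]
  refine sublistDerivsBdd_of_listDeriv (fun i => ((stdVec i, 0) : RSpace n × RSpace n))
    (List.nodup_finRange n) fun β hβ z => ?_
  rw [CBSpace.coe_listDeriv, CBSpace.coe_listDeriv]
  exact norm_mixedDeriv_le_symbolNorm (CBSpace.isCBInfty a) hβ hγ z

/-- The rescaling `a ↦ ((x, η) ↦ a(x, 2π η))` as a linear map. -/
noncomputable def CBSpace.rescale :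
    CBSpace (RSpace n × RSpace n) A →ₗ[ℝ] CBSpace (RSpace n × RSpace n) A where
  toFun f := ⟨rescaleSymbol (f : RSpace n × RSpace n → A), (CBSpace.isCBInfty f).rescaleSymbol⟩
  map_add' _ _ := rfl
  map_smul' _ _ := rfl

theorem CBSpace.rescale_apply (f : CBSpace (RSpace n × RSpace n) A) (z : RSpace n × RSpace n) :
    (CBSpace.rescale f : RSpace n × RSpace n → A) z = f.1 (z.1, (2 * Real.pi) • z.2) := rfl

theorem CBSpace.deriv_rescale (v w : RSpace n) (f : CBSpace (RSpace n × RSpace n) A) :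
    CBSpace.deriv (v, w) (CBSpace.rescale f) =
      CBSpace.rescale (CBSpace.deriv (v, (2 * Real.pi) • w) f) := by
  refine Subtype.ext (funext fun z => ?_)
  simp [CBSpace.deriv_apply, CBSpace.rescale_apply, lineDeriv, smul_smul, mul_comm]

theorem CBSpace.deriv_smul_direction (c : ℝ) (v : V) (f : CBSpace V F) :
    CBSpace.deriv (c • v) f = c • CBSpace.deriv v f := by
  refine Subtype.ext (funext fun z => ?_)
  have hf := (CBSpace.isCBInfty f).differentiable z
  simp [CBSpace.deriv_apply, hf.lineDeriv_eq_fderiv]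

theorem SublistDerivsBdd.rescale_left {l : List (RSpace n)} {M : ℝ}
    {f : CBSpace (RSpace n × RSpace n) A}
    (hf : SublistDerivsBdd (l.map fun v => (v, 0)) M f) :
    SublistDerivsBdd (l.map fun v => (v, 0)) M (CBSpace.rescale f) := by
  induction l generalizing f with
  | nil => exact fun z => hf _
  | cons v l ih =>
    refine ⟨ih hf.1, ?_⟩
    rw [CBSpace.deriv_rescale, smul_zero]
    exact ih hf.2

/-- By the chain rule each η-derivative of a(x, 2πη) costs a factor 2π and x-derivatives cost
nothing; as 2π ≥ 1, the full power also covers shorter sublists. -/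
theorem SublistDerivsBdd.rescale {l l' : List (RSpace n)} {M : ℝ} (hM : 0 ≤ M)
    {f : CBSpace (RSpace n × RSpace n) A}
    (hf : SublistDerivsBdd (l.map (fun v => (0, v)) ++ l'.map fun v => (v, 0)) M f) :
    SublistDerivsBdd (l.map (fun v => (0, v)) ++ l'.map fun v => (v, 0))
      ((2 * Real.pi) ^ l.length * M) (CBSpace.rescale f) := by
  induction l generalizing f with
  | nil => simpa using SublistDerivsBdd.rescale_left hf
  | cons v l ih =>
    have hpi : 1 ≤ 2 * Real.pi := by linarith [Real.pi_gt_three]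
    refine ⟨(ih hf.1).mono ?_, ?_⟩
    · exact mul_le_mul_of_nonneg_right (pow_le_pow_right₀ hpi (by simp)) hM
    · have he : ((0, (2 * Real.pi) • v) : RSpace n × RSpace n) = (2 * Real.pi) • (0, v) := by simp
      rw [CBSpace.deriv_rescale, he, CBSpace.deriv_smul_direction, map_smul]
      refine ((ih hf.2).smul (2 * Real.pi)).mono (le_of_eq ?_)
      rw [abs_of_nonneg (by positivity), List.length_cons]
      ring

end SymbolNorm

/-! ### The bound for the pairing and the theorem -/

section MainTheorem

open scoped FourierTransform

variable {n : ℕ} {A : Type*} [NonUnitalCStarAlgebra A]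

variable (n A) in
theorem exists_norm_schwartzInner_pdo_le : ∃ K, 0 ≤ K ∧ ∀ (a : RSpace n × RSpace n → A)
    (ha : IsCBInfty a) (v u : 𝓢(RSpace n, A)),
    ‖schwartzInner v (pdo (rescaleSymbol a) ha.rescaleSymbol u)‖ ≤
      K * symbolNorm a * schwartzNorm₂ v * schwartzNorm₂ u := by
  obtain ⟨K, hK, hest⟩ := exists_phaseIntegrand_estimate (A := A) (List.finRange n).reverse
    isWindow_prodWindow
  -- The factor 2^n comes from ∏ⱼ (1 - ∂_{ηⱼ}) applied to the symbol, and (2π)^n from the rescaling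
  -- ξ = 2πη.
  refine ⟨K * (2 ^ n * (2 * Real.pi) ^ n), by positivity, fun a ha v u => ?_⟩
  have h1 := sublistDerivsBdd_symbolNorm (⟨a, ha⟩ : CBSpace (RSpace n × RSpace n) A)
  have hlist : ((List.finRange n).reverse.map fun i => ((stdVec i, 0) : RSpace n × RSpace n)) =
      (stdVecList n).map fun v => (v, 0) := by
    rw [stdVecList, ← List.map_reverse, List.map_map]
    rfl
  have hlen : (stdVecList n).length = n := by simp [stdVecList]
  rw [hlist] at h1
  have h2 := (h1.rescale (symbolNorm_nonneg _)).oneSubDeriv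
  rw [List.length_map, hlen, ← hlist] at h2
  obtain ⟨hi, hn⟩ := hest _ _ u (𝓕⁻ (schwartzStar v)) h2
  have h3 := integral_star_mul_pdoFun (CBSpace.rescale ⟨a, ha⟩) v u hi
  rw [integral_fourierInv_star_mul_star] at hn
  refine (congrArg norm h3).trans_le (hn.trans_eq ?_)
  rw [schwartzNorm₂, schwartzNorm₂]
  simp only [schwartzInner]
  ring

end MainTheorem

theorem mainTheorem4 (n : ℕ) (A : Type*) [NonUnitalCStarAlgebra A]
    [TopologicalSpace.SeparableSpace A] :
    ∃ k : ℝ, 0 < k ∧ ∀ a : RSpace n × RSpace n → A, IsCBInfty a →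
      ∃ T : 𝓢(RSpace n, A) →ₗ[ℂ] 𝓢(RSpace n, A),
        IsPseudoDiffOp a T ∧
        (∀ (u v : 𝓢(RSpace n, A)) (b : A), (∀ x, v x = u x * b) → ∀ x, T v x = T u x * b) ∧
        ∀ u : 𝓢(RSpace n, A), schwartzNorm₂ (T u) ≤ k * symbolNorm a * schwartzNorm₂ u := by
  obtain ⟨K, hK, hest⟩ := exists_norm_schwartzInner_pdo_le n A
  -- `K` is only known to be nonnegative; adding 1 makes the constant positive.
  refine ⟨K + 1, by positivity, fun a ha => ⟨pdo (rescaleSymbol a) ha.rescaleSymbol,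
    isPseudoDiffOp_pdo ha, fun u v b h x => pdo_mul_right _ h x, fun u => ?_⟩⟩
  set v := pdo (rescaleSymbol a) ha.rescaleSymbol u
  have hv0 : 0 ≤ schwartzNorm₂ v := Real.sqrt_nonneg _
  have hu0 : 0 ≤ schwartzNorm₂ u := Real.sqrt_nonneg _
  have ha0 := symbolNorm_nonneg a
  -- The pairing bound is tested on v = Tu, where ‖⟨v, v⟩‖ = ‖v‖₂²; one factor ‖v‖₂ is then
  -- cancelled unless it vanishes.
  have h1 : schwartzNorm₂ v * schwartzNorm₂ v ≤
      (K * symbolNorm a * schwartzNorm₂ u) * schwartzNorm₂ v := by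
    have h2 := hest a ha v u
    rw [schwartzNorm₂, Real.mul_self_sqrt (norm_nonneg _)]
    exact h2.trans_eq (by rw [schwartzNorm₂]; ring)
  have h3 : schwartzNorm₂ v ≤ K * symbolNorm a * schwartzNorm₂ u := by
    rcases hv0.eq_or_lt with h | h
    · rw [← h]; positivity
    · exact le_of_mul_le_mul_right h1 h
  refine h3.trans ?_
  gcongr
  linarith
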